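/- **Two-stage codes for the Z-channel.** All logarithms $\log$ are to base $2$, $\ln$ is the natural logarithm, and $h(p)=-p\log p-(1-p)\log(1-p)$ on $[0,1]$. For $x,y\in\{0,1\}^n$ let $\Delta(x,y)=\#\{i: x_i=1,\ y_i=0\}$ and $d_Z(x,y)=2\max(\Delta(x,y),\Delta(y,x))$. A two-stage code with $M$ messages and length $n=n_1+n_2$, $1<n_1<n$, consists of maps $f:[M]\to\{0,1\}^{n_1}$ and $g:[M]\times\{0,1\}^{n_1}\to\{0,1\}^{n_2}$. The possible outputs for message $m$ under at most $t$ asymmetric errors are the pairs $(y_1,y_2)\in\{0,1\}^{n_1}\times\{0,1\}^{n_2}$ with $y_1\le f(m)$, $y_2\le g(m,y_1)$ (coordinatewise) and $\Delta(f(m),y_1)+\Delta(g(m,y_1),y_2)\le t$. The code corrects $t$ errors if some decoder recovers $m$ from every possible output for $m$, for all $m\in[M]$. Let $M_Z^{(2)}(n,t)$ be the largest $M$ for which such a code correcting $t$ errors exists for some $n_1$ with $1<n_1<n$, and let $$R_Z^{(2)}(\tau)=\limsup_{n\to\infty}\frac{\log M_Z^{(2)}(n,\lfloor\tau n\rfloor)}{n}.$$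 For $M\ge 1$ let $\tau(M)$ be the supremum of all $\delta>0$ such that, for some $n\ge 1$, there is a code $\mathcal C\subset\{0,1\}^n$ of size $M$ with $d_Z(x,y)\ge 2n\delta$ for all distinct $x,y\in\mathcal C$ (thus $\tau(1)=+\infty$). For an integer $L\ge 0$, $\omega\in[0,1]$ and $s>0$ put $$Z(s,L,\omega)=\omega^{L+1}+(1-\omega)^{L+1}+\sum_{i=1}^{L}e^{-si/(L+1)}\binom{L+1}{i}\omega^i(1-\omega)^{L+1-i},\qquad g(s,L,\omega)=-\ln Z(s,L,\omega),$$ $$\delta(s,L,\omega)=\frac{1}{Z(s,L,\omega)}\sum_{i=1}^{L}e^{-si/(L+1)}\binom{L}{i-1}\omega^i(1-\omega)^{L+1-i},$$ and for real $R$ let $$\tau^*(R,L,\omega)=\sup\{\delta(s,L,\omega):\ s>0,\ g(s,L,\omega)-s\,\delta(s,L,\omega)\ge RL\ln 2\},\qquad \sup\emptyset=0.$$ For $0\le\alpha<1$ let $$R_2=R_2(\alpha,x,\omega,R)=\frac{\alpha(1-\omega+x)}{1-\alpha}\left(h\!\left(\frac{x}{1-\omega+x}\right)-h\!\left(\frac{1-\sqrt{\max\{0,\,1-4\tau^*(R,1,\omega)/(1-\omega+x)\}}}{2}\right)\right).$$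 **Theorem.** Let $0<\tau<1$ and let $L_{up}$ be a positive integer. Then $$R_Z^{(2)}(\tau)\ \ge\ \sup_{0\le\omega\le1}\ \sup_{0\le\alpha<1}\ \sup_{\substack{0\le R\le h(\omega)\\ \text{subject to }(*)}}\alpha R,$$ where $(*)$ means that for every $x\in(0,\min(\omega,\tau/\alpha))$ (with $\tau/0=+\infty$): 1. for every $L\in\{1,\dots,L_{up}\}$ with $\tau^*(R,L-1,\omega)\le x\le\tau^*(R,L,\omega)$, one has $\dfrac{\tau-\alpha x}{1-\alpha}\le\tau(L)$; 2. if $\tau^*(R,L_{up},\omega)\le x$, then $\dfrac{\tau-\alpha x}{1-\alpha}\le\tau^*(R_2,1,1/2)$. -/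

import Mathlib

namespace ZChannel

/-- `Delta x y` is the number of positions `i` with `x i = 1` and `y i = 0`. -/
def Delta {n : ℕ} (x y : Fin n → Bool) : ℕ :=
  (Finset.univ.filter fun i => x i = true ∧ y i = false).card

/-- The asymmetric distance `2 max (Δ(x,y), Δ(y,x))`. -/
def asymDist {n : ℕ} (x y : Fin n → Bool) : ℕ :=
  2 * max (Delta x y) (Delta y x)

/-- The possible channel outputs `(y₁, y₂)` for a two-stage encoder `(f, g)` and the message `m`,
when at most `t` errors occur in total. Errors only turn a `1` into a `0`, so `yᵢ` is
coordinatewise below the transmitted word; the second-stage word may depend on `m` and on the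
word `y₁` received in the first stage. -/
def outputs {n₁ n₂ M : ℕ} (f : Fin M → (Fin n₁ → Bool))
    (g : Fin M → (Fin n₁ → Bool) → (Fin n₂ → Bool)) (t : ℕ) (m : Fin M) :
    Set ((Fin n₁ → Bool) × (Fin n₂ → Bool)) :=
  {y | Delta y.1 (f m) = 0 ∧ Delta y.2 (g m y.1) = 0 ∧
    Delta (f m) y.1 + Delta (g m y.1) y.2 ≤ t}

/-- `M` messages can be transmitted with `n₁` channel uses in the first stage and `n₂` in the
second one against `t` errors: there are an encoder and a decoder that is always correct. -/
def TwoStageAchievable (n₁ n₂ t M : ℕ) : Prop :=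
  ∃ (f : Fin M → (Fin n₁ → Bool)) (g : Fin M → (Fin n₁ → Bool) → (Fin n₂ → Bool))
    (dec : (Fin n₁ → Bool) × (Fin n₂ → Bool) → Fin M),
    ∀ m : Fin M, ∀ y ∈ outputs f g t m, dec y = m

/-- The numbers of messages that can be transmitted with `n` channel uses against `t` errors,
the feedback moment `n₁` with `1 < n₁ < n` being chosen in advance. -/
def twoStageSizes (n t : ℕ) : Set ℕ :=
  {M | ∃ n₁ n₂ : ℕ, 1 < n₁ ∧ 0 < n₂ ∧ n₁ + n₂ = n ∧ TwoStageAchievable n₁ n₂ t M}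

theorem bddAbove_twoStageSizes (n t : ℕ) : BddAbove (twoStageSizes n t) := by
  refine ⟨2 ^ n, ?_⟩
  rintro M ⟨n₁, n₂, -, -, rfl, f, g, dec, hdec⟩
  have hinj : Function.Injective fun m : Fin M => (f m, g m (f m)) := by
    have key : ∀ m, dec (f m, g m (f m)) = m := fun m =>
      hdec m _ (by simp [outputs, Delta])
    intro a b hab
    have h := congrArg dec hab
    simpa only [key] using h
  have h := Fintype.card_le_of_injective _ hinj
  simpa [pow_add] using h

/-- The maximum number of messages in two-stage transmission. -/
noncomputable def twoStageMax (n t : ℕ) : ℕ := sSup (twoStageSizes n t)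

/-- The maximal asymptotic rate of two-stage error-correcting codes for the Z-channel. -/
noncomputable def twoStageRate (τ : ℝ) : EReal :=
  Filter.limsup
    (fun n : ℕ => ((Real.logb 2 (twoStageMax n ⌊τ * n⌋₊ : ℝ) / n : ℝ) : EReal)) Filter.atTop

/-- The maximal fraction `δ` such that some code of size `M` and some length `n` has minimal
asymmetric distance at least `2 n δ`. For `M = 1` there is no pair of distinct codewords and the
value is `⊤`. -/
noncomputable def maxFraction (M : ℕ) : EReal :=
  ⨆ δ ∈ {δ : ℝ | 0 < δ ∧ ∃ n : ℕ, 0 < n ∧ ∃ C : Finset (Fin n → Bool), C.card = M ∧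
    ∀ x ∈ C, ∀ y ∈ C, x ≠ y → 2 * (n : ℝ) * δ ≤ asymDist x y}, (δ : EReal)

/-- The binary entropy function, with logarithms to base `2`. -/
noncomputable def entropy (p : ℝ) : ℝ := Real.binEntropy p / Real.log 2

/-- `ω^(L+1) + (1-ω)^(L+1) + ∑_{i=1}^{L} exp(-s i/(L+1)) C(L+1,i) ω^i (1-ω)^(L+1-i)`. -/
noncomputable def partitionSum (s : ℝ) (L : ℕ) (ω : ℝ) : ℝ :=
  ω ^ (L + 1) + (1 - ω) ^ (L + 1) +
    ∑ i ∈ Finset.Icc 1 L, Real.exp (-(s * i / (L + 1))) * ((L + 1).choose i : ℝ) *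
      ω ^ i * (1 - ω) ^ (L + 1 - i)

noncomputable def gFun (s : ℝ) (L : ℕ) (ω : ℝ) : ℝ := -Real.log (partitionSum s L ω)

noncomputable def deltaFun (s : ℝ) (L : ℕ) (ω : ℝ) : ℝ :=
  (∑ i ∈ Finset.Icc 1 L, Real.exp (-(s * i / (L + 1))) * (L.choose (i - 1) : ℝ) *
      ω ^ i * (1 - ω) ^ (L + 1 - i)) / partitionSum s L ω

/-- `τ*(R, L, ω)`: the supremum of `δ(s, L, ω)` over all `s > 0` with
`g(s, L, ω) - s δ(s, L, ω) ≥ R L ln 2`. These values are nonnegative, and the supremum is `0`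
when no `s` is admissible. -/
noncomputable def tauStar (R : ℝ) (L : ℕ) (ω : ℝ) : ℝ :=
  sSup {d : ℝ | ∃ s : ℝ, 0 < s ∧
    R * L * Real.log 2 ≤ gFun s L ω - s * deltaFun s L ω ∧ d = deltaFun s L ω}

/-- The rate `R₂` of the second-stage code, for a fraction `x` of errors in the first stage.
The square root is read as `0` when its argument is negative (as `Real.sqrt` does). -/
noncomputable def secondRate (α x ω R : ℝ) : ℝ :=
  α * (1 - ω + x) / (1 - α) *
    (entropy (x / (1 - ω + x)) -
      entropy ((1 - Real.sqrt (1 - 4 * tauStar R 1 ω / (1 - ω + x))) / 2))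

/-- The condition `(*)`. The range `x < ω`, `α * x < τ` is `x < min (ω, τ / α)`, with
`τ / 0 = +∞`. -/
def Admissible (τ : ℝ) (Lup : ℕ) (ω α R : ℝ) : Prop :=
  ∀ x : ℝ, 0 < x → x < ω → α * x < τ →
    (∀ L ∈ Finset.Icc 1 Lup, tauStar R (L - 1) ω ≤ x → x ≤ tauStar R L ω →
      (((τ - α * x) / (1 - α) : ℝ) : EReal) ≤ maxFraction L) ∧
    (tauStar R Lup ω ≤ x →
      (τ - α * x) / (1 - α) ≤ tauStar (secondRate α x ω R) 1 (1 / 2))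

end ZChannel

/-!
The first stage uses a constant-weight code of length `n₁ ≈ α n` and weight `≈ ω n₁`. A random such
code of rate slightly below `R` can be expurgated so that, for all `L ≤ Lup` simultaneously, any
`L + 1` codewords have overlap at most the weight minus `ρ_L n₁`, where `ρ_L > τ*(R, L, ω)`; the
quantity `τ*` is the Chernoff exponent of this event.

When `x n₁` errors have occurred, the receiver sees a set `Y` contained in the transmitted
codeword, and has to decide among the codewords containing `Y`. If `x < ρ_L`, there are at most `L`
of them, so repeating an optimal code of size `L` separates them against `τ n - x n₁` further
errors provided `(τ - α x) / (1 - α) < τ(L)`. If `x` exceeds all `ρ_L`, the codewords containing `Y`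
form a constant-weight code on the positions outside `Y`; Elias–Bassalygo averaging and the Johnson
bound limit their number, and a Gilbert–Varshamov code separates them.

The condition `(*)` only gives non-strict inequalities at `x`, but using it slightly to the left of
`x` makes them strict, as `(τ - α x) / (1 - α)` is strictly decreasing in `x`.
-/

namespace ZChannel

open Finset Filter Topology
open scoped symmDiff Pointwise

theorem card_sdiff_add_card_sdiff {α : Type*} [DecidableEq α] (A B : Finset α) :
    #(A \ B) + #(B \ A) = #(A ∆ B) := by
  rw [symmDiff_def, sup_eq_union, card_union_of_disjoint disjoint_sdiff_sdiff]

theorem card_sdiff_comm {α : Type*} [DecidableEq α] {A B : Finset α} (h : #A = #B) :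
    #(A \ B) = #(B \ A) := by
  have hA := card_sdiff_add_card_inter A B
  have hB := card_sdiff_add_card_inter B A
  rw [inter_comm] at hB
  omega

section SetFamilies

variable {α : Type*} [Fintype α] [DecidableEq α]

theorem sum_card_filter_mem (F : Finset (Finset α)) :
    ∑ i, #{A ∈ F | i ∈ A} = ∑ A ∈ F, #A := by
  simpa [bipartiteAbove, bipartiteBelow] using
    sum_card_bipartiteAbove_eq_sum_card_bipartiteBelow (s := univ) (t := F) (· ∈ ·)

theorem sum_card_filter_mem_sq (F : Finset (Finset α)) :
    ∑ i, #{A ∈ F | i ∈ A} ^ 2 = ∑ A ∈ F, ∑ B ∈ F, #(A ∩ B) := by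
  simp only [card_filter, sq, sum_mul_sum]
  rw [sum_comm]
  refine sum_congr rfl fun A _ => ?_
  rw [sum_comm]
  refine sum_congr rfl fun B _ => ?_
  simp only [mul_ite, mul_one, mul_zero, ← ite_and, and_comm, ← mem_inter, sum_boole,
    filter_mem_eq_inter, univ_inter, Nat.cast_id]

theorem card_le_mul_card_of_le_card_sdiff {F : Finset (Finset α)} {m d : ℕ}
    (hF : ∀ A ∈ F, #A = m) (hd : (F : Set (Finset α)).Pairwise fun A B => d ≤ #(A \ B))
    (hm : (m : ℤ) * (Fintype.card α - m) < d * Fintype.card α) :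
    #F ≤ d * Fintype.card α := by
  rcases F.eq_empty_or_nonempty with rfl | hne
  · simp
  set N := Fintype.card α
  have hrow : ∀ A ∈ F, ∑ B ∈ F, (#(A ∩ B) : ℤ) ≤ d + #F * ((m : ℤ) - d) := by
    intro A hA
    calc ∑ B ∈ F, (#(A ∩ B) : ℤ) ≤ ∑ B ∈ F, (((m : ℤ) - d) + if A = B then (d : ℤ) else 0) := by
          refine sum_le_sum fun B hB => ?_
          have := card_sdiff_add_card_inter A B
          have := hF A hA
          split_ifs with h
          · omega
          · have := hd hA hB h
            omega
      _ = d + #F * ((m : ℤ) - d) := by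
          rw [sum_add_distrib, sum_ite_eq, if_pos hA, sum_const, nsmul_eq_mul, add_comm]
  have hpos : (0 : ℤ) < #F := by exact_mod_cast hne.card_pos
  have hcauchy : (#F : ℤ) * (#F * m * m) ≤ #F * (N * (d + #F * ((m : ℤ) - d))) := by
    calc (#F : ℤ) * (#F * m * m) = ((∑ i, #{A ∈ F | i ∈ A} : ℕ) : ℤ) ^ 2 := by
          rw [sum_card_filter_mem, sum_congr rfl hF, sum_const, smul_eq_mul]
          push_cast
          ring
      _ ≤ N * ((∑ i, #{A ∈ F | i ∈ A} ^ 2 : ℕ) : ℤ) := by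
          exact_mod_cast sq_sum_le_card_mul_sum_sq (s := (univ : Finset α))
      _ ≤ N * ∑ _A ∈ F, ((d : ℤ) + #F * ((m : ℤ) - d)) := by
          rw [sum_card_filter_mem_sq]
          push_cast
          gcongr with A hA
          exact hrow A hA
      _ = #F * (N * (d + #F * ((m : ℤ) - d))) := by
          rw [sum_const, nsmul_eq_mul]
          ring
  have h := le_of_mul_le_mul_left hcauchy hpos
  exact_mod_cast (by nlinarith : (#F : ℤ) ≤ d * N)

theorem exists_eq_of_le_succ {q : ℕ → ℕ} (hq : ∀ v, q (v + 1) ≤ q v + 1) {k N : ℕ}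
    (h0 : q 0 ≤ k) (hN : k ≤ q N) : ∃ v ≤ N, q v = k := by
  induction N with
  | zero => exact ⟨0, le_rfl, le_antisymm h0 hN⟩
  | succ N ih =>
    rcases le_or_gt k (q N) with h | h
    · obtain ⟨v, hv, rfl⟩ := ih h
      exact ⟨v, hv.trans N.le_succ, rfl⟩
    · exact ⟨N + 1, le_rfl, le_antisymm ((hq N).trans h) hN⟩

/-- Along a maximal chain of sets the distance to a fixed `m`-set moves from `m` to `N - m` in
unit steps. -/
theorem exists_chain_card_symmDiff_eq {m k : ℕ} (hmk : m ≤ k) (hk : k + m ≤ Fintype.card α) :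
    ∃ I : ℕ → Finset α, ∀ S : Finset α, #S = m →
      ∃ v ≤ Fintype.card α, #(I v ∆ S) = k := by
  let e := Fintype.equivFin α
  refine ⟨fun v => {i | (e i : ℕ) < v}, fun S hS => exists_eq_of_le_succ (fun v => ?_) ?_ ?_⟩
  · have hstep : #{i | (e i : ℕ) = v} ≤ 1 :=
      card_le_one.2 fun a ha b hb => e.injective (Fin.ext (by simp_all))
    refine (card_le_card fun i => ?_).trans ((card_union_le _ _).trans (by gcongr))
    simp only [mem_symmDiff, mem_union, mem_filter, mem_univ, true_and, Nat.lt_succ_iff_lt_or_eq]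
    tauto
  · simpa [← Finset.bot_eq_empty, hS] using hmk
  · have huniv : ({i | (e i : ℕ) < Fintype.card α} : Finset α) = ⊤ := by ext; simp
    simp only [huniv, top_symmDiff, hnot_eq_compl, card_compl, hS]
    omega

theorem exists_choose_le_mul_card_filter {m k : ℕ} (hmk : m ≤ k) (hk : k + m ≤ Fintype.card α) :
    ∃ Z : Finset α, (Fintype.card α).choose m ≤
      (Fintype.card α + 1) * #{S ∈ powersetCard m univ | #(Z ∆ S) = k} := by
  obtain ⟨I, hI⟩ := exists_chain_card_symmDiff_eq (α := α) hmk hk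
  set N := Fintype.card α
  by_contra! h
  have hcover : powersetCard m (univ : Finset α) ⊆
      (range (N + 1)).biUnion fun v => {S ∈ powersetCard m univ | #(I v ∆ S) = k} := by
    intro S hS
    obtain ⟨v, hv, hvk⟩ := hI S (mem_powersetCard.1 hS).2
    exact mem_biUnion.2 ⟨v, mem_range.2 (Nat.lt_succ_of_le hv), mem_filter.2 ⟨hS, hvk⟩⟩
  have hcard := (card_le_card hcover).trans card_biUnion_le
  rw [card_powersetCard, card_univ] at hcard
  have hlt := sum_lt_sum_of_nonempty (nonempty_range_add_one (n := N)) fun v _ => h (I v)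
  rw [← mul_sum, sum_const, card_range, smul_eq_mul] at hlt
  exact absurd hcard (lt_of_mul_lt_mul_left hlt (Nat.zero_le _)).not_ge

end SetFamilies

section TransitiveAction

variable {G X : Type*} [Group G] [Fintype X] [DecidableEq X] [MulAction G X]
  [MulAction.IsPretransitive G X]

theorem card_mul_card_filter_smul_eq [Fintype G] (x y : X) :
    Fintype.card X * #{g : G | g • x = y} = Fintype.card G := by
  have hfiber : ∀ z, #{g : G | g • x = z} = #{g : G | g • x = y} := by
    intro z
    obtain ⟨h, rfl⟩ := MulAction.exists_smul_eq G y z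
    exact card_equiv (Equiv.mulLeft h⁻¹) fun g => by simp [mul_smul, inv_smul_eq_iff]
  calc Fintype.card X * #{g : G | g • x = y} = ∑ z, #{g : G | g • x = z} := by
        simp only [hfiber, sum_const, card_univ, smul_eq_mul]
    _ = Fintype.card G := (card_eq_sum_card_fiberwise (by simp)).symm

theorem exists_smul_card_mul_card_le [Finite G] (F E : Finset X) :
    ∃ g : G, #F * #E ≤ Fintype.card X * #{x ∈ F | g • x ∈ E} := by
  cases nonempty_fintype G
  have hcount : ∑ g : G, Fintype.card X * #{x ∈ F | g • x ∈ E} = ∑ _g : G, #F * #E := by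
    calc ∑ g : G, Fintype.card X * #{x ∈ F | g • x ∈ E}
        = ∑ x ∈ F, Fintype.card X * #{g : G | g • x ∈ E} := by
          rw [← mul_sum, ← mul_sum]
          congr 1
          exact sum_card_bipartiteAbove_eq_sum_card_bipartiteBelow fun (g : G) x => g • x ∈ E
      _ = ∑ x ∈ F, ∑ y ∈ E, Fintype.card X * #{g : G | g • x = y} := by
          refine sum_congr rfl fun x _ => ?_
          rw [← mul_sum, card_eq_sum_card_fiberwise (t := E) (f := (· • x)) (by intro; simp)]
          congr 1
          refine sum_congr rfl fun y hy => ?_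
          rw [filter_filter]
          congr 1
          ext g
          simp only [mem_filter, mem_univ, true_and, and_iff_right_iff_imp]
          rintro rfl
          exact hy
      _ = ∑ _g : G, #F * #E := by
          simp only [card_mul_card_filter_smul_eq, sum_const, card_univ, smul_eq_mul]
          ring
  obtain ⟨g, -, hg⟩ := exists_le_of_sum_le univ_nonempty hcount.ge
  exact ⟨g, hg⟩

end TransitiveAction

theorem exists_perm_card_mul_card_le {α : Type*} [Fintype α] [DecidableEq α] {k : ℕ}
    {F E : Finset (Finset α)} (hF : ∀ A ∈ F, #A = k) (hE : ∀ A ∈ E, #A = k) :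
    ∃ π : Equiv.Perm α, #F * #E ≤ (Fintype.card α).choose k * #{A ∈ F | π • A ∈ E} := by
  classical
  have := Set.powersetCard.isPretransitive (α := α) (n := k)
  obtain ⟨π, hπ⟩ := exists_smul_card_mul_card_le (G := Equiv.Perm α)
    (F.subtype (· ∈ Set.powersetCard α k)) (E.subtype (· ∈ Set.powersetCard α k))
  have hcard : ∀ {D : Finset (Finset α)}, (∀ A ∈ D, #A = k) →
      #(D.subtype (· ∈ Set.powersetCard α k)) = #D := fun hD => by
    rw [card_subtype, filter_true_of_mem (p := (· ∈ Set.powersetCard α k)) hD]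
  rw [hcard hF, hcard hE, ← Nat.card_eq_fintype_card, Set.powersetCard.card,
    Nat.card_eq_fintype_card] at hπ
  refine ⟨π, hπ.trans (Nat.mul_le_mul_left _ ?_)⟩
  exact card_le_card_of_injOn Subtype.val (fun A hA => by simpa using hA)
    Subtype.val_injective.injOn

theorem card_symmDiff_smul_symmDiff {α : Type*} [DecidableEq α] (Z A B : Finset α)
    (π : Equiv.Perm α) :
    #((Z ∆ (π • A)) ∆ (Z ∆ (π • B))) = #(A ∆ B) := by
  rw [symmDiff_symmDiff_symmDiff_comm, symmDiff_self, bot_symmDiff, ← smul_finset_symmDiff,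
    card_smul_finset]

theorem le_card_sdiff_of_card_symmDiff_eq {α : Type*} [DecidableEq α]
    {A B S T : Finset α} {d : ℕ} (hST : #S = #T) (h : #(S ∆ T) = #(A ∆ B)) (hAB : d ≤ #(A \ B))
    (hBA : d ≤ #(B \ A)) :
    d ≤ #(S \ T) := by
  have hcomm := card_sdiff_comm hST
  have := card_sdiff_add_card_sdiff S T
  have := card_sdiff_add_card_sdiff A B
  omega

section ConstantWeight

variable {α : Type*} [Fintype α] [DecidableEq α] {F : Finset (Finset α)} {m k d : ℕ}

theorem card_mul_choose_le (hF : ∀ A ∈ F, #A = k)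
    (hd : (F : Set (Finset α)).Pairwise fun A B => d ≤ #(A \ B)) (hmk : m ≤ k)
    (hk : k + m ≤ Fintype.card α)
    (hm : (m : ℤ) * (Fintype.card α - m) < d * Fintype.card α) :
    #F * (Fintype.card α).choose m ≤
      (Fintype.card α + 1) * (d * Fintype.card α) * (Fintype.card α).choose k := by
  set N := Fintype.card α
  obtain ⟨Z, hZ⟩ := exists_choose_le_mul_card_filter (α := α) hmk hk
  set E : Finset (Finset α) := {S ∈ powersetCard m univ | #(Z ∆ S) = k}
  have hE : #(E.image (Z ∆ ·)) = #E := card_image_of_injective _ (symmDiff_right_injective Z)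
  obtain ⟨π, hπ⟩ := exists_perm_card_mul_card_le (E := E.image (Z ∆ ·)) hF (by grind)
  have hinj : Function.Injective fun A : Finset α => Z ∆ (π • A) :=
    (symmDiff_right_injective Z).comp (MulAction.injective π)
  set F' : Finset (Finset α) := {A ∈ F | π • A ∈ E.image (Z ∆ ·)}.image fun A => Z ∆ (π • A)
  have hF'card : ∀ S ∈ F', #S = m := by
    intro S hS
    obtain ⟨A, hA, rfl⟩ := mem_image.1 hS
    obtain ⟨S, hS, hSA⟩ := mem_image.1 (mem_filter.1 hA).2
    rw [← hSA, symmDiff_symmDiff_cancel_left]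
    exact (mem_powersetCard.1 (mem_filter.1 hS).1).2
  have hF'sep : (F' : Set (Finset α)).Pairwise fun A B => d ≤ #(A \ B) := by
    intro S hS T hT hST
    have hcard := (hF'card S hS).trans (hF'card T hT).symm
    obtain ⟨A, hA, rfl⟩ := mem_image.1 hS
    obtain ⟨B, hB, rfl⟩ := mem_image.1 hT
    have hAB : A ≠ B := fun h => hST (h ▸ rfl)
    have hA := (mem_filter.1 hA).1
    have hB := (mem_filter.1 hB).1
    exact le_card_sdiff_of_card_symmDiff_eq hcard (card_symmDiff_smul_symmDiff Z A B π)
      (hd hA hB hAB) (hd hB hA hAB.symm)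
  have hjohnson := card_le_mul_card_of_le_card_sdiff hF'card hF'sep hm
  rw [card_image_of_injective _ hinj] at hjohnson
  calc #F * N.choose m ≤ #F * ((N + 1) * #E) := by gcongr
    _ = (N + 1) * (#F * #(E.image (Z ∆ ·))) := by rw [hE]; ring
    _ ≤ (N + 1) * (N.choose k * (d * N)) :=
        Nat.mul_le_mul_left _ (hπ.trans (Nat.mul_le_mul_left _ hjohnson))
    _ = (N + 1) * (d * N) * N.choose k := by ring

theorem card_mul_choose_le_max (hF : ∀ A ∈ F, #A = k)
    (hd : (F : Set (Finset α)).Pairwise fun A B => d ≤ #(A \ B)) (hmN : 2 * m ≤ Fintype.card α)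
    (hm : (m : ℤ) * (Fintype.card α - m) < d * Fintype.card α) :
    #F * (Fintype.card α).choose m ≤ (Fintype.card α + 1) ^ 3 *
      max ((Fintype.card α).choose k) ((Fintype.card α).choose m) := by
  set N := Fintype.card α
  rcases le_or_gt #F 1 with h1 | h1
  · exact Nat.mul_le_mul (h1.trans (Nat.one_le_pow _ _ N.succ_pos)) (le_max_right _ _)
  obtain ⟨A, hA, B, hB, hAB⟩ := one_lt_card.1 h1
  have hdN : d * N ≤ (N + 1) ^ 2 := by
    have hdN : d ≤ N := (hd hA hB hAB).trans (card_le_univ _)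
    nlinarith
  have : k ≤ N := hF A hA ▸ card_le_univ A
  by_cases hk : m ≤ k ∧ k + m ≤ N
  · calc #F * N.choose m ≤ (N + 1) * (d * N) * N.choose k := card_mul_choose_le hF hd hk.1 hk.2 hm
      _ ≤ (N + 1) * (N + 1) ^ 2 * max (N.choose k) (N.choose m) := by
        gcongr; exact le_max_left _ _
      _ = _ := by ring
  · have hkm : (k : ℤ) * (N - k) ≤ m * (N - m) := by
      rcases lt_or_ge k m with h | h
      · nlinarith
      · have : N < k + m := by omega
        nlinarith
    refine Nat.mul_le_mul ?_ (le_max_right _ _)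
    calc #F ≤ d * N := card_le_mul_card_of_le_card_sdiff hF hd (hkm.trans_lt hm)
      _ ≤ (N + 1) ^ 3 := hdN.trans (Nat.pow_le_pow_right N.succ_pos (by norm_num))

end ConstantWeight

section Binomial

variable {N k : ℕ}

theorem choose_mul_pow_le_mode {j : ℕ} (hk : k ≤ N) (hj : j ≤ N) :
    N.choose j * (k ^ j * (N - k) ^ (N - j)) ≤ N.choose k * (k ^ k * (N - k) ^ (N - k)) := by
  set U : ℕ → ℕ := fun j => N.choose j * (k ^ j * (N - k) ^ (N - j)) with hU
  have hratio : ∀ j < N, U (j + 1) * ((j + 1) * (N - k)) = U j * (k * (N - j)) := by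
    intro j hj
    have hpow : (N - k) ^ (N - j) = (N - k) ^ (N - (j + 1)) * (N - k) := by
      rw [← pow_succ, Nat.sub_add_eq, Nat.sub_add_cancel (Nat.sub_pos_of_lt hj)]
    calc U (j + 1) * ((j + 1) * (N - k))
        = (N.choose (j + 1) * (j + 1)) * (k ^ (j + 1) * ((N - k) ^ (N - (j + 1)) * (N - k))) := by
          simp only [hU]; ring
      _ = U j * (k * (N - j)) := by
          rw [Nat.choose_succ_right_eq, ← hpow]; simp only [hU]; ring
  rcases le_total j k with h | h
  · rcases hk.eq_or_lt with rfl | hkN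
    · rcases h.eq_or_lt with rfl | h
      · exact le_rfl
      · simp [(Nat.sub_pos_of_lt h).ne']
    refine Nat.decreasingInduction (motive := fun i _ => U i ≤ U k)
      (fun i hi ih => le_trans ?_ ih) le_rfl h
    refine le_of_mul_le_mul_right ?_ (Nat.mul_pos i.succ_pos (Nat.sub_pos_of_lt hkN))
    rw [hratio i (hi.trans hkN)]
    gcongr
    omega
  · induction j, h using Nat.le_induction with
    | base => exact le_rfl
    | succ i hi ih =>
      refine le_trans ?_ (ih (by omega))
      refine le_of_mul_le_mul_right ?_ (Nat.mul_pos i.succ_pos (by omega : 0 < N - k))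
      rw [hratio i hj]
      gcongr
      omega

theorem sum_choose_mul_pow (hk : k ≤ N) :
    ∑ j ∈ range (N + 1), N.choose j * (k ^ j * (N - k) ^ (N - j)) = N ^ N := by
  conv_rhs => rw [← Nat.add_sub_cancel' hk, add_pow, Nat.add_sub_cancel' hk]
  exact sum_congr rfl fun j _ => mul_comm _ _

theorem pow_self_le_mul_choose_mul_pow (hk : k ≤ N) :
    N ^ N ≤ (N + 1) * (N.choose k * (k ^ k * (N - k) ^ (N - k))) := by
  rw [← sum_choose_mul_pow hk]
  simpa using sum_le_card_nsmul (range (N + 1)) _ _ fun j hj =>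
    choose_mul_pow_le_mode hk (Nat.lt_succ_iff.1 (mem_range.1 hj))

theorem exp_mul_binEntropy (hk : k ≤ N) :
    Real.exp (N * Real.binEntropy (k / N)) * ((k : ℝ) ^ k * ((N - k : ℕ) : ℝ) ^ (N - k)) =
      (N : ℝ) ^ N := by
  rcases N.eq_zero_or_pos with rfl | hN
  · simp [Nat.le_zero.1 hk]
  have hN : (N : ℝ) ≠ 0 := by exact_mod_cast hN.ne'
  have hexp : ∀ a : ℕ, Real.exp (-(a * Real.log (a / N))) * (a : ℝ) ^ a = (N : ℝ) ^ a := by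
    intro a
    rcases a.eq_zero_or_pos with rfl | ha
    · simp
    rw [Real.exp_neg, Real.exp_nat_mul, Real.exp_log (by positivity), div_pow]
    field_simp
  have hsplit : (N : ℝ) * Real.binEntropy (k / N) =
      -(k * Real.log (k / N)) + -((N - k : ℕ) * Real.log ((N - k : ℕ) / N)) := by
    rw [Real.binEntropy, Real.log_inv, Real.log_inv, Nat.cast_sub hk, sub_div, div_self hN]
    field_simp
  rw [hsplit, Real.exp_add, mul_mul_mul_comm, hexp, hexp, ← pow_add, Nat.add_sub_cancel' hk]

theorem pow_self_mul_pow_self_pos (a b : ℕ) : (0 : ℝ) < (a : ℝ) ^ a * (b : ℝ) ^ b := by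
  exact_mod_cast Nat.mul_pos (Nat.pow_self_pos (n := a)) (Nat.pow_self_pos (n := b))

theorem choose_le_exp_binEntropy (hk : k ≤ N) :
    (N.choose k : ℝ) ≤ Real.exp (N * Real.binEntropy (k / N)) := by
  have hterm : N.choose k * (k ^ k * (N - k) ^ (N - k)) ≤ N ^ N := by
    rw [← sum_choose_mul_pow hk]
    exact single_le_sum (f := fun j => N.choose j * (k ^ j * (N - k) ^ (N - j)))
      (fun _ _ => Nat.zero_le _) (mem_range.2 (Nat.lt_succ_of_le hk))
  refine le_of_mul_le_mul_right ?_ (pow_self_mul_pow_self_pos k (N - k))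
  rw [exp_mul_binEntropy hk]
  exact_mod_cast hterm

theorem exp_binEntropy_le_choose (hk : k ≤ N) :
    Real.exp (N * Real.binEntropy (k / N)) ≤ (N + 1) * N.choose k := by
  refine le_of_mul_le_mul_right ?_ (pow_self_mul_pow_self_pos k (N - k))
  rw [exp_mul_binEntropy hk, mul_assoc]
  exact_mod_cast pow_self_le_mul_choose_mul_pow hk

end Binomial

section Ball

variable {α : Type*} [Fintype α]

theorem card_filter_card_le_pos (D : ℕ) : 0 < #{S : Finset α | #S ≤ D} :=
  card_pos.2 ⟨∅, by simp⟩

theorem card_filter_card_symmDiff_le [DecidableEq α] (A : Finset α) (D : ℕ) :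
    #{B | #(A ∆ B) ≤ D} = #{S : Finset α | #S ≤ D} :=
  card_equiv (symmDiff_right_involutive A).toPerm (by simp)

theorem card_filter_card_le_mul_pow_le (D : ℕ) {u : ℝ} (hu0 : 0 ≤ u) (hu1 : u ≤ 1) :
    (#{S : Finset α | #S ≤ D} : ℝ) * u ^ D ≤ (1 + u) ^ Fintype.card α := by
  rw [add_comm, ← Fintype.sum_pow_mul_eq_add_pow, ← nsmul_eq_mul, ← sum_const]
  calc ∑ _S ∈ {S : Finset α | #S ≤ D}, u ^ D
      ≤ ∑ S ∈ {S : Finset α | #S ≤ D}, u ^ #S * 1 ^ (Fintype.card α - #S) := by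
        refine sum_le_sum fun S hS => ?_
        rw [one_pow, mul_one]
        exact pow_le_pow_of_le_one hu0 hu1 (mem_filter.1 hS).2
    _ ≤ _ := sum_le_sum_of_subset_of_nonneg (subset_univ _) fun _ _ _ => by positivity

/-- Chernoff's method with the optimal tilt `u = p / (1 - p)`. -/
theorem card_filter_card_le_exp_binEntropy {D : ℕ} {p : ℝ} (hp0 : 0 < p) (hp1 : p ≤ 1 / 2)
    (hD : (D : ℝ) ≤ p * Fintype.card α) :
    (#{S : Finset α | #S ≤ D} : ℝ) ≤ Real.exp (Fintype.card α * Real.binEntropy p) := by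
  have hq : 0 < 1 - p := by linarith
  have htilt := card_filter_card_le_mul_pow_le (α := α) D (u := p / (1 - p)) (by positivity)
    (by rw [div_le_one hq]; linarith)
  rw [show 1 + p / (1 - p) = (1 - p)⁻¹ by field_simp; ring, ← Real.exp_log hq, ← Real.exp_neg,
    ← Real.exp_nat_mul, Real.exp_log hq, ← Real.exp_log (div_pos hp0 hq), ← Real.exp_nat_mul,
    Real.log_div hp0.ne' hq.ne', ← le_div_iff₀ (Real.exp_pos _), ← Real.exp_sub] at htilt
  refine htilt.trans (Real.exp_le_exp.2 ?_)
  have hlog : Real.log p ≤ Real.log (1 - p) := Real.log_le_log hp0 (by linarith)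
  rw [Real.binEntropy, Real.log_inv, Real.log_inv]
  nlinarith

end Ball

theorem exists_subset_pairwise_not_card_le {α : Type*} (X : Finset α)
    {r : α → α → Prop} [DecidableRel r] (hrefl : ∀ a, r a a) (hsymm : ∀ a b, r a b → r b a)
    {V : ℕ} (hV : ∀ a ∈ X, #{b ∈ X | r a b} ≤ V) :
    ∃ C ⊆ X, #X ≤ #C * V ∧ (C : Set α).Pairwise fun a b => ¬ r a b := by
  classical
  let P : Finset (Finset α) := {C ∈ X.powerset | (C : Set α).Pairwise fun a b => ¬ r a b}
  obtain ⟨C, hC⟩ := P.exists_maximal ⟨∅, by simp [P]⟩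
  obtain ⟨hCX, hCr⟩ := mem_filter.1 hC.prop
  rw [mem_powerset] at hCX
  have hcover : X ⊆ C.biUnion fun a => {b ∈ X | r a b} := by
    intro b hb
    by_contra hcon
    simp only [mem_biUnion, mem_filter, not_exists, not_and] at hcon
    have hinsert : insert b C ∈ P := by
      refine mem_filter.2 ⟨mem_powerset.2 (insert_subset hb hCX), ?_⟩
      rw [coe_insert]
      exact hCr.insert fun a ha _ => ⟨fun h => hcon a ha hb (hsymm _ _ h), hcon a ha hb⟩
    exact hcon b (hC.le_of_ge hinsert (subset_insert b C) (mem_insert_self b C)) hb (hrefl b)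
  exact ⟨C, hCX, (card_le_card hcover).trans
    (card_biUnion_le_card_mul _ _ _ fun a ha => hV a (hCX ha)), hCr⟩

/-- There are at least `K` words of length `n`, identified with their supports, which correct `r`
asymmetric errors: an output common to the supports `A` and `B` is a subset of `A ∩ B`, so it
arises from `r` errors exactly when `max #(A \ B) #(B \ A) ≤ r`. -/
def HasCode (n K r : ℕ) : Prop :=
  ∃ C : Finset (Finset (Fin n)), K ≤ #C ∧
    (C : Set (Finset (Fin n))).Pairwise fun A B => r < max #(A \ B) #(B \ A)

section Codes

variable {n K r : ℕ}

theorem hasCode_of_le_one (hK : K ≤ 1) : HasCode n K r :=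
  ⟨{∅}, by simpa using hK, by simp⟩

theorem HasCode.mono {K' r' : ℕ} (h : HasCode n K r) (hK : K' ≤ K) (hr : r' ≤ r) :
    HasCode n K' r' := by
  obtain ⟨C, hC, hsep⟩ := h
  exact ⟨C, hK.trans hC, fun A hA B hB hAB => hr.trans_lt (hsep hA hB hAB)⟩

theorem hasCode_of_mul_card_le
    (h : K * #{S : Finset (Fin n) | #S ≤ 2 * r} ≤ 2 ^ n) : HasCode n K r := by
  obtain ⟨C, -, hcard, hsep⟩ := exists_subset_pairwise_not_card_le (univ : Finset (Finset (Fin n)))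
    (r := fun A B => #(A ∆ B) ≤ 2 * r) (by simp) (fun A B h => by rwa [symmDiff_comm])
    fun A _ => (card_filter_card_symmDiff_le A (2 * r)).le
  refine ⟨C, ?_, fun A hA B hB hAB => ?_⟩
  · rw [card_univ, Fintype.card_finset, Fintype.card_fin] at hcard
    exact le_of_mul_le_mul_right (h.trans hcard) (card_filter_card_le_pos _)
  · have := hsep hA hB hAB
    have := card_sdiff_add_card_sdiff A B
    omega

theorem hasCode_of_le_exp {p : ℝ} (hp0 : 0 < p) (hp1 : p ≤ 1 / 2) (hr : 2 * (r : ℝ) ≤ p * n)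
    (hK : (K : ℝ) ≤ Real.exp (n * (Real.log 2 - Real.binEntropy p))) : HasCode n K r := by
  refine hasCode_of_mul_card_le ?_
  have hball := card_filter_card_le_exp_binEntropy (α := Fin n) (D := 2 * r) hp0 hp1
    (by rw [Fintype.card_fin]; exact_mod_cast hr)
  rw [Fintype.card_fin] at hball
  have hprod : (K : ℝ) * #{S : Finset (Fin n) | #S ≤ 2 * r} ≤ 2 ^ n := by
    calc (K : ℝ) * #{S : Finset (Fin n) | #S ≤ 2 * r}
        ≤ Real.exp (n * (Real.log 2 - Real.binEntropy p)) *
          Real.exp (n * Real.binEntropy p) := by gcongr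
      _ = 2 ^ n := by
        rw [← Real.exp_add, ← mul_add, sub_add_cancel, Real.exp_nat_mul,
          Real.exp_log (by norm_num)]
  exact_mod_cast hprod

theorem HasCode.of_image {ι : Type*} {C : Finset ι} {f : ι → Finset (Fin n)}
    (hK : K ≤ #C) (hf : (C : Set ι).Pairwise fun a b => r < max #(f a \ f b) #(f b \ f a)) :
    HasCode n K r := by
  classical
  have hinj : Set.InjOn f C := by
    intro a ha b hb h
    by_contra hab
    simpa [h] using hf ha hb hab
  refine ⟨C.image f, by rwa [card_image_of_injOn hinj], ?_⟩
  rw [coe_image]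
  exact hinj.pairwise_image.2 hf

theorem HasCode.repetition {n₀ : ℕ} (h : HasCode n₀ K r) {q s : ℕ} (hqn : q * n₀ ≤ n)
    (hs : s < q * (r + 1)) : HasCode n K s := by
  obtain ⟨C, hK, hsep⟩ := h
  let e : Fin q × Fin n₀ ↪ Fin n := finProdFinEquiv.toEmbedding.trans (Fin.castLEEmb hqn)
  have hcopy : ∀ A B : Finset (Fin n₀),
      #((univ ×ˢ A).map e \ (univ ×ˢ B).map e) = q * #(A \ B) := by
    intro A B
    have hsdiff : (univ : Finset (Fin q)) ×ˢ A \ univ ×ˢ B = univ ×ˢ (A \ B) := by ext; simp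
    rw [← Finset.map_sdiff, card_map, hsdiff, card_product, card_univ, Fintype.card_fin]
  refine HasCode.of_image (f := fun A => (univ ×ˢ A).map e) hK fun A hA B hB hAB => ?_
  beta_reduce
  rw [hcopy, hcopy, Nat.mul_max_mul_left]
  exact hs.trans_le (Nat.mul_le_mul_left q (hsep hA hB hAB))

end Codes

section Transpose

variable {α ι : Type*} [Fintype α] [Fintype ι] [DecidableEq α] [DecidableEq ι]

/-- The transpose of a family of sets, that is, of the incidence matrix of the family: it sends
a position to the set of members that contain it. -/
def transpose : (ι → Finset α) ≃ (α → Finset ι) where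
  toFun c i := {j | i ∈ c j}
  invFun k j := {i | j ∈ k i}
  left_inv c := by ext; simp
  right_inv k := by ext; simp

theorem sum_card_transpose (c : ι → Finset α) : ∑ i, #(transpose c i) = ∑ j, #(c j) := by
  simpa [bipartiteAbove, bipartiteBelow, transpose] using
    sum_card_bipartiteAbove_eq_sum_card_bipartiteBelow (s := univ) (t := univ)
      fun (i : α) (j : ι) => i ∈ c j

theorem sum_card_compl_transpose (c : ι → Finset α) :
    ∑ i, (Fintype.card ι - #(transpose c i)) = ∑ j, (Fintype.card α - #(c j)) := by
  have hcompl : ∀ i, transpose (fun j => (c j)ᶜ) i = (transpose c i)ᶜ := fun i => by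
    ext; simp [transpose]
  simpa only [hcompl, card_compl] using sum_card_transpose fun j => (c j)ᶜ

/-- The number of positions common to all members of a family of sets. -/
def overlap (c : ι → Finset α) : ℕ := #{i | ∀ j, i ∈ c j}

theorem overlap_eq_card_filter_transpose (c : ι → Finset α) :
    overlap c = #{i | #(transpose c i) = Fintype.card ι} := by
  simp [overlap, transpose, card_eq_iff_eq_univ, eq_univ_iff_forall]

end Transpose

section Chernoff

/-- The weight, in the Chernoff bound with parameter `s`, of a position contained in exactly `i`
members of a family of `l + 1` random sets of density `p`. -/
noncomputable def columnWeight (s p : ℝ) (l i : ℕ) : ℝ :=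
  p ^ i * (1 - p) ^ (l + 1 - i) *
    Real.exp (-s * ((i : ℝ) / (l + 1) - if i = l + 1 then 1 else 0))

theorem columnWeight_nonneg {p : ℝ} (hp0 : 0 ≤ p) (hp1 : p ≤ 1) (s : ℝ) (l i : ℕ) :
    0 ≤ columnWeight s p l i := by
  have : 0 ≤ 1 - p := sub_nonneg.2 hp1
  unfold columnWeight
  positivity

theorem sum_columnWeight (s p : ℝ) (l : ℕ) :
    ∑ K : Finset (Fin (l + 1)), columnWeight s p l #K = partitionSum s l p := by
  have hl : ((l : ℝ) + 1) ≠ 0 := by positivity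
  have hfirst : columnWeight s p l 0 = (1 - p) ^ (l + 1) := by simp [columnWeight]
  have hlast : columnWeight s p l (l + 1) = p ^ (l + 1) := by simp [columnWeight, div_self hl]
  have hmid : ∀ i ∈ Ico 1 (l + 1), (l + 1).choose i • columnWeight s p l i =
      Real.exp (-(s * i / (l + 1))) * (l + 1).choose i * p ^ i * (1 - p) ^ (l + 1 - i) := by
    intro i hi
    rw [columnWeight, if_neg (mem_Ico.1 hi).2.ne, sub_zero, nsmul_eq_mul, neg_mul, mul_div_assoc]
    ring
  calc ∑ K : Finset (Fin (l + 1)), columnWeight s p l #K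
      = ∑ i ∈ range (l + 1 + 1), (l + 1).choose i • columnWeight s p l i := by
        simpa using sum_powerset_apply_card (x := (univ : Finset (Fin (l + 1))))
          (columnWeight s p l)
    _ = partitionSum s l p := by
        rw [sum_range_succ, range_eq_Ico, sum_eq_sum_Ico_succ_bot l.succ_pos, sum_congr rfl hmid,
          hfirst, hlast, partitionSum, Nat.choose_zero_right, Nat.choose_self, one_smul, one_smul,
          add_comm, add_comm ((1 - p) ^ _), ← add_assoc, add_right_comm]
        rfl

variable {α : Type*} [Fintype α] [DecidableEq α] {w : ℕ}

theorem prod_columnWeight {l : ℕ} {c : Fin (l + 1) → Finset α} (hc : ∀ j, #(c j) = w) (s p : ℝ) :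
    ∏ i, columnWeight s p l #(transpose c i) =
      (p ^ w * (1 - p) ^ (Fintype.card α - w)) ^ (l + 1) *
        Real.exp (-s * ((w : ℝ) - overlap c)) := by
  have hsum : ∑ i, #(transpose c i) = (l + 1) * w := by simp [sum_card_transpose, hc]
  have hcompl : ∑ i, (l + 1 - #(transpose c i)) = (l + 1) * (Fintype.card α - w) := by
    simpa [hc] using sum_card_compl_transpose c
  have hover : ∑ i, (if #(transpose c i) = l + 1 then (1 : ℝ) else 0) = overlap c := by
    rw [sum_boole, overlap_eq_card_filter_transpose, Fintype.card_fin]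
  have hmean : (((l + 1) * w : ℕ) : ℝ) / (l + 1) = w := by
    push_cast
    field_simp
  simp only [columnWeight]
  rw [prod_mul_distrib, prod_mul_distrib, prod_pow_eq_pow_sum, prod_pow_eq_pow_sum, hsum, hcompl,
    ← Real.exp_sum, ← mul_sum, sum_sub_distrib, hover, ← sum_div, ← Nat.cast_sum, hsum, hmean,
    mul_comm (l + 1) w, mul_comm (l + 1) (_ - w), pow_mul, pow_mul, mul_pow]

theorem one_le_mul_choose_mul_pow {n : ℕ} (hw : w ≤ n) :
    1 ≤ ((n : ℝ) + 1) * n.choose w * (((w : ℝ) / n) ^ w * (1 - (w : ℝ) / n) ^ (n - w)) := by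
  rcases n.eq_zero_or_pos with rfl | hn
  · simp [Nat.le_zero.1 hw]
  have hn : (0 : ℝ) < n := by exact_mod_cast hn
  have hcompl : 1 - (w : ℝ) / n = ((n - w : ℕ) : ℝ) / n := by
    rw [Nat.cast_sub hw, sub_div, div_self hn.ne']
  rw [hcompl, div_pow, div_pow, div_mul_div_comm, ← pow_add, Nat.add_sub_cancel' hw,
    mul_div_assoc', le_div_iff₀ (by positivity), one_mul, mul_assoc]
  exact_mod_cast pow_self_le_mul_choose_mul_pow hw

open Classical in
/-- The `(l + 1)`-tuples of `w`-sets with more than `w - θ` common positions. -/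
noncomputable def badTuples (α : Type*) [Fintype α] [DecidableEq α] (w l : ℕ) (θ : ℝ) :
    Finset (Fin (l + 1) → Finset α) :=
  {c ∈ Fintype.piFinset fun _ => powersetCard w univ | (w : ℝ) < overlap c + θ}

variable {l : ℕ} {θ : ℝ}

theorem mem_badTuples {c : Fin (l + 1) → Finset α} :
    c ∈ badTuples α w l θ ↔ (∀ j, #(c j) = w) ∧ (w : ℝ) < overlap c + θ := by
  simp [badTuples, Fintype.mem_piFinset, mem_powersetCard]

theorem card_badTuples_mul_pow_le {s p : ℝ} (hs : 0 ≤ s) (hp0 : 0 ≤ p) (hp1 : p ≤ 1) :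
    (#(badTuples α w l θ) : ℝ) * (p ^ w * (1 - p) ^ (Fintype.card α - w)) ^ (l + 1) ≤
      partitionSum s l p ^ Fintype.card α * Real.exp (s * θ) := by
  have : 0 ≤ 1 - p := sub_nonneg.2 hp1
  rw [← nsmul_eq_mul, ← sum_const]
  calc ∑ _c ∈ badTuples α w l θ, (p ^ w * (1 - p) ^ (Fintype.card α - w)) ^ (l + 1)
      ≤ ∑ c ∈ badTuples α w l θ,
          (∏ i, columnWeight s p l #(transpose c i)) * Real.exp (s * θ) := by
        refine sum_le_sum fun c hc => ?_
        obtain ⟨hcw, hcθ⟩ := mem_badTuples.1 hc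
        rw [prod_columnWeight hcw, mul_assoc, ← Real.exp_add]
        exact le_mul_of_one_le_right (by positivity) (Real.one_le_exp (by nlinarith))
    _ ≤ ∑ c, (∏ i, columnWeight s p l #(transpose c i)) * Real.exp (s * θ) :=
        sum_le_sum_of_subset_of_nonneg (subset_univ _) fun c _ _ =>
          mul_nonneg (prod_nonneg fun i _ => columnWeight_nonneg hp0 hp1 _ _ _) (Real.exp_pos _).le
    _ = partitionSum s l p ^ Fintype.card α * Real.exp (s * θ) := by
        rw [← sum_mul, transpose.sum_comp fun k => ∏ i, columnWeight s p l #(k i),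
          ← Fintype.piFinset_univ, ← prod_univ_sum _ fun _ K => columnWeight s p l #K,
          prod_const, card_univ, sum_columnWeight]

/-- The binomial distribution of density `w / N` puts mass at least `1 / (N + 1)` on the sets of
size `w`, so that independent positions can replace uniformly random `w`-sets. -/
theorem card_badTuples_le (hw : w ≤ Fintype.card α) {s : ℝ} (hs : 0 ≤ s) :
    (#(badTuples α w l θ) : ℝ) ≤
      ((Fintype.card α + 1 : ℝ) * (Fintype.card α).choose w) ^ (l + 1) *
        (partitionSum s l (w / Fintype.card α) ^ Fintype.card α * Real.exp (s * θ)) := by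
  set N := Fintype.card α
  set q : ℝ := ((w : ℝ) / N) ^ w * (1 - (w : ℝ) / N) ^ (N - w)
  calc (#(badTuples α w l θ) : ℝ)
      ≤ #(badTuples α w l θ) * ((N + 1 : ℝ) * N.choose w * q) ^ (l + 1) :=
        le_mul_of_one_le_right (by positivity) (one_le_pow₀ (one_le_mul_choose_mul_pow hw))
    _ = ((N + 1 : ℝ) * N.choose w) ^ (l + 1) * (#(badTuples α w l θ) * q ^ (l + 1)) := by
        rw [mul_pow]; ring
    _ ≤ _ :=
        mul_le_mul_of_nonneg_left (card_badTuples_mul_pow_le hs (by positivity)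
          (div_le_one_of_le₀ (Nat.cast_le.2 hw) N.cast_nonneg)) (by positivity)

theorem card_badTuples_one_le :
    #(badTuples α w 1 θ) ≤
      (Fintype.card α).choose w * #{S : Finset α | #S ≤ ⌊2 * θ⌋₊} := by
  rw [← card_univ, ← card_powersetCard, ← card_product]
  refine card_le_card_of_injOn (fun c => (c 0, c 0 ∆ c 1)) (fun c hc => ?_) fun c _ c' _ h => ?_
  · obtain ⟨hcw, hcθ⟩ := mem_badTuples.1 hc
    have hinter : overlap c = #(c 0 ∩ c 1) := by
      rw [overlap]; congr 1; ext; simp [Fin.forall_fin_two]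
    have hsymm : #(c 0 ∆ c 1) + 2 * overlap c = w + w := by
      have := card_sdiff_add_card_sdiff (c 0) (c 1)
      have := card_sdiff_add_card_inter (c 0) (c 1)
      have := card_sdiff_comm ((hcw 0).trans (hcw 1).symm)
      have := hcw 0
      omega
    have hsymm : (#(c 0 ∆ c 1) : ℝ) + 2 * overlap c = w + w := by exact_mod_cast hsymm
    simp only [coe_product, Set.mem_prod, mem_coe, mem_powersetCard_univ, hcw 0, mem_filter,
      mem_univ, true_and]
    exact Nat.le_floor (by linarith)
  · obtain ⟨h0, h1⟩ := Prod.mk.inj h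
    rw [h0] at h1
    funext j
    fin_cases j
    exacts [h0, symmDiff_right_injective _ h1]

end Chernoff

section Expurgation

variable {β ι : Type*} [Fintype ι] (X : Finset β)

theorem card_filter_comp_mem_mul_le [DecidableEq β] [DecidableEq ι] {κ : Type*} [Fintype κ]
    (B : Finset (κ → β)) {f : κ → ι} (hf : f.Injective) :
    #{φ ∈ Fintype.piFinset (fun _ : ι => X) | φ ∘ f ∈ B} * #X ^ Fintype.card κ ≤
      #B * #X ^ Fintype.card ι := by
  classical
  rw [← card_univ (α := ι), ← card_univ (α := κ), ← prod_const, ← prod_const,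
    ← Fintype.card_piFinset, ← Fintype.card_piFinset, ← card_product, ← card_product]
  have hswap : ∀ (φ : ι → β) ψ, f.extend (φ ∘ f) (f.extend ψ φ) = φ ∧ f.extend ψ φ ∘ f = ψ := by
    refine fun φ ψ => ⟨funext fun a => ?_, Function.extend_comp hf _ _⟩
    by_cases ha : ∃ j, f j = a
    · obtain ⟨j, rfl⟩ := ha
      rw [hf.extend_apply, Function.comp_apply]
    · rw [Function.extend_apply' _ _ _ ha, Function.extend_apply' _ _ _ ha]
  refine card_le_card_of_injOn (fun x => (x.1 ∘ f, f.extend x.2 x.1)) (fun x hx => ?_) <|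
    Set.LeftInvOn.injOn (f₁' := fun y => (f.extend y.1 y.2, y.2 ∘ f)) fun x _ =>
      Prod.ext (hswap x.1 x.2).1 (hswap x.1 x.2).2
  simp only [coe_product, Set.mem_prod, mem_coe, mem_filter, Fintype.mem_piFinset] at hx ⊢
  refine ⟨hx.1.2, fun a => ?_⟩
  by_cases ha : ∃ j, f j = a
  · obtain ⟨j, rfl⟩ := ha
    exact (hf.extend_apply _ _ j).symm ▸ hx.2 j
  · exact (Function.extend_apply' _ _ _ ha).symm ▸ hx.1.1 a

open Classical in
theorem sum_card_filter_injective_comp_mem_le [DecidableEq β] [DecidableEq ι] {κ : Type*}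
    [Fintype κ] [DecidableEq κ] (hX : X.Nonempty) (B : Finset (κ → β)) :
    (∑ φ ∈ Fintype.piFinset fun _ : ι => X, #{f : κ → ι | f.Injective ∧ φ ∘ f ∈ B} : ℝ) ≤
      #X ^ Fintype.card ι *
        (Fintype.card ι ^ Fintype.card κ * (#B / #X ^ Fintype.card κ)) := by
  have : (0 : ℝ) < #X := mod_cast hX.card_pos
  set Ω := Fintype.piFinset fun _ : ι => X
  calc (∑ φ ∈ Ω, #{f : κ → ι | f.Injective ∧ φ ∘ f ∈ B} : ℝ)
      = ∑ f : κ → ι, (#{φ ∈ Ω | f.Injective ∧ φ ∘ f ∈ B} : ℝ) :=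
        mod_cast sum_card_bipartiteAbove_eq_sum_card_bipartiteBelow
          fun φ (f : κ → ι) => f.Injective ∧ φ ∘ f ∈ B
    _ ≤ ∑ _f : κ → ι, #X ^ Fintype.card ι * (#B / #X ^ Fintype.card κ : ℝ) := by
        refine sum_le_sum fun f _ => ?_
        by_cases hf : f.Injective
        · simp only [hf, true_and]
          rw [mul_div_assoc', le_div_iff₀ (by positivity), mul_comm ((#X : ℝ) ^ _)]
          exact mod_cast card_filter_comp_mem_mul_le X B hf
        · simp only [hf, false_and, filter_false, card_empty, Nat.cast_zero]
          positivity
    _ = _ := by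
        rw [sum_const, nsmul_eq_mul, card_univ, Fintype.card_fun]
        push_cast
        ring

variable {K : Type*} (I : Finset K) {k : K → ℕ}

theorem exists_avoiding (J : ∀ i, Finset (Fin (k i + 1) → ι)) :
    ∃ G : Finset ι, Fintype.card ι ≤ #G + ∑ i ∈ I, #(J i) ∧
      ∀ i ∈ I, ∀ f ∈ J i, ∃ j, f j ∉ G := by
  classical
  set bad : Finset ι := I.biUnion fun i => (J i).image fun f => f 0
  have hbad : #bad ≤ ∑ i ∈ I, #(J i) :=
    card_biUnion_le.trans (sum_le_sum fun _ _ => card_image_le)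
  refine ⟨badᶜ, by have := card_compl_add_card bad; omega, fun i hi f hf => ⟨0, ?_⟩⟩
  rw [mem_compl, not_not]
  exact mem_biUnion.2 ⟨i, hi, mem_image_of_mem _ hf⟩

theorem exists_expurgated (hX : X.Nonempty) (B : ∀ i, Finset (Fin (k i + 1) → β))
    (h : ∑ i ∈ I, (Fintype.card ι : ℝ) ^ (k i + 1) * (#(B i) / (#X : ℝ) ^ (k i + 1)) ≤
      Fintype.card ι / 2) :
    ∃ φ : ι → β, (∀ a, φ a ∈ X) ∧ ∃ G : Finset ι, (Fintype.card ι : ℝ) / 2 ≤ #G ∧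
      ∀ i ∈ I, ∀ f : Fin (k i + 1) → ι, f.Injective → (∀ j, f j ∈ G) → φ ∘ f ∉ B i := by
  classical
  let J (φ : ι → β) (i : K) : Finset (Fin (k i + 1) → ι) := {f | f.Injective ∧ φ ∘ f ∈ B i}
  set Ω := Fintype.piFinset fun _ : ι => X
  have hmean : ∑ φ ∈ Ω, ∑ i ∈ I, (#(J φ i) : ℝ) ≤ ∑ φ ∈ Ω, (Fintype.card ι : ℝ) / 2 := by
    rw [sum_comm, sum_const, Fintype.card_piFinset, prod_const, card_univ, nsmul_eq_mul,
      Nat.cast_pow]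
    refine le_trans ?_ (mul_le_mul_of_nonneg_left h (by positivity))
    rw [mul_sum]
    exact sum_le_sum fun i _ => by
      simpa using sum_card_filter_injective_comp_mem_le (ι := ι) X hX (B i)
  obtain ⟨φ, hφ, hle⟩ := exists_le_of_sum_le
    (Fintype.piFinset_nonempty.2 fun _ => hX : Ω.Nonempty) hmean
  obtain ⟨G, hG, havoid⟩ := exists_avoiding I (J φ)
  refine ⟨φ, Fintype.mem_piFinset.1 hφ, G, ?_, fun i hi f hf hfG hbad => ?_⟩
  · have hG : (Fintype.card ι : ℝ) ≤ #G + ∑ i ∈ I, (#(J φ i) : ℝ) := mod_cast hG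
    linarith
  · obtain ⟨j, hj⟩ := havoid i hi f (mem_filter.2 ⟨mem_univ _, hf, hbad⟩)
    exact hj (hfG j)

end Expurgation

section Spread

variable {α : Type*} [Fintype α] [DecidableEq α] {C : Finset (Finset α)} {w l m : ℕ} {θ : ℝ}

/-- A family of `w`-sets any `l + 1` distinct members of which have at most `w - θ` common
positions: after fewer than `θ` asymmetric errors, at most `l` codewords remain possible. -/
def Spread (C : Finset (Finset α)) (w l : ℕ) (θ : ℝ) : Prop :=
  ∀ c : Fin (l + 1) → Finset α, c.Injective → (∀ j, c j ∈ C) → overlap c + θ ≤ w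

theorem Spread.mono (h : Spread C w l θ) (hlm : l ≤ m) : Spread C w m θ := by
  intro c hc hcC
  have hle : l + 1 ≤ m + 1 := Nat.succ_le_succ hlm
  refine le_trans ?_ (h (c ∘ Fin.castLE hle) (hc.comp (Fin.castLE_injective hle)) fun _ => hcC _)
  gcongr
  exact card_le_card fun i hi => by simp_all

theorem exists_spread_code (hw : w ≤ Fintype.card α) (M : ℕ) {K : Type*} {I : Finset K} {k : K → ℕ}
    {θ : K → ℝ} {i₀ : K} (hi₀ : i₀ ∈ I) (hk : k i₀ = 1) (hθ : 0 < θ i₀)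
    (h : ∑ i ∈ I, (M : ℝ) ^ (k i + 1) *
      (#(badTuples α w (k i) (θ i)) / ((Fintype.card α).choose w : ℝ) ^ (k i + 1)) ≤ M / 2) :
    ∃ C : Finset (Finset α), (∀ A ∈ C, #A = w) ∧ (M : ℝ) / 2 ≤ #C ∧
      ∀ i ∈ I, Spread C w (k i) (θ i) := by
  classical
  have hX : #(powersetCard w (univ : Finset α)) = (Fintype.card α).choose w := by simp
  obtain ⟨φ, hφ, G, hG, hgood⟩ := exists_expurgated (ι := Fin M) (powersetCard w univ) I
    (card_pos.1 (hX ▸ Nat.choose_pos hw)) (fun i => badTuples α w (k i) (θ i))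
    (by rwa [hX, Fintype.card_fin])
  rw [Fintype.card_fin] at hG
  have hφw : ∀ a, #(φ a) = w := fun a => (mem_powersetCard.1 (hφ a)).2
  have hgood : ∀ i ∈ I, ∀ f : Fin (k i + 1) → Fin M, f.Injective → (∀ j, f j ∈ G) →
      overlap (φ ∘ f) + θ i ≤ w := fun i hi f hf hfG => not_lt.1 fun hlt =>
    hgood i hi f hf hfG (mem_badTuples.2 ⟨fun j => hφw (f j), hlt⟩)
  have hinj : Set.InjOn φ G := by
    intro a ha b hb hab
    by_contra hne
    have hpairs := hgood i₀ hi₀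
    rw [hk] at hpairs
    have hle := hpairs ![a, b]
      (by simpa [Function.Injective, Fin.forall_fin_two, eq_comm] using hne)
      (by simpa [Fin.forall_fin_two] using ⟨ha, hb⟩)
    have hover : overlap (φ ∘ ![a, b]) = w := by
      simp [overlap, Fin.forall_fin_two, ← hab, hφw]
    linarith [hover ▸ hle]
  refine ⟨G.image φ, by simpa using fun a _ => hφw a, by rwa [card_image_of_injOn hinj], ?_⟩
  intro i hi c hc hcC
  choose f hfG hf using fun j => mem_image.1 (hcC j)
  obtain rfl : φ ∘ f = c := funext hf
  exact hgood i hi f hc.of_comp hfG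

end Spread

section Limits

theorem tendsto_log_succ_div : Tendsto (fun n : ℕ => Real.log (n + 1) / n) atTop (𝓝 0) := by
  simpa [Function.comp_def] using (Real.tendsto_pow_log_div_mul_add_atTop 1 (-1) 1 one_ne_zero).comp
    (tendsto_atTop_add_const_right atTop (1 : ℝ) tendsto_natCast_atTop_atTop)

theorem tendsto_floor_mul_div {ω : ℝ} (h0 : 0 ≤ ω) :
    Tendsto (fun n : ℕ => (⌊ω * n⌋₊ : ℝ) / n) atTop (𝓝 ω) :=
  (tendsto_nat_floor_mul_div_atTop h0).comp tendsto_natCast_atTop_atTop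

theorem floor_mul_le {ω : ℝ} (h1 : ω ≤ 1) (n : ℕ) : ⌊ω * n⌋₊ ≤ n :=
  Nat.floor_le_of_le (mul_le_of_le_one_left n.cast_nonneg h1)

end Limits

section TauStar

variable {ω : ℝ} (h0 : 0 ≤ ω) (h1 : ω ≤ 1)

theorem continuous_partitionSum (s : ℝ) (l : ℕ) : Continuous (partitionSum s l) := by
  unfold partitionSum
  fun_prop

include h0 h1

theorem pow_add_pow_pos (l : ℕ) : 0 < ω ^ l + (1 - ω) ^ l := by
  have := sub_nonneg.2 h1
  rcases h0.eq_or_lt with rfl | h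
  · simp only [sub_zero, one_pow]
    positivity
  · positivity

theorem pow_add_pow_le_partitionSum (s : ℝ) (l : ℕ) :
    ω ^ (l + 1) + (1 - ω) ^ (l + 1) ≤ partitionSum s l ω := by
  have := sub_nonneg.2 h1
  exact le_add_of_nonneg_right (sum_nonneg fun i _ => by positivity)

theorem partitionSum_pos (s : ℝ) (l : ℕ) : 0 < partitionSum s l ω :=
  (pow_add_pow_pos h0 h1 _).trans_le (pow_add_pow_le_partitionSum h0 h1 s l)

theorem gFun_le (s : ℝ) (l : ℕ) : gFun s l ω ≤ -Real.log (ω ^ (l + 1) + (1 - ω) ^ (l + 1)) :=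
  neg_le_neg (Real.log_le_log (pow_add_pow_pos h0 h1 _) (pow_add_pow_le_partitionSum h0 h1 s l))

theorem deltaFun_nonneg (s : ℝ) (l : ℕ) : 0 ≤ deltaFun s l ω := by
  have := sub_nonneg.2 h1
  exact div_nonneg (sum_nonneg fun i _ => by positivity) (partitionSum_pos h0 h1 s l).le

theorem tauStar_nonneg (R : ℝ) (l : ℕ) : 0 ≤ tauStar R l ω := by
  refine Real.sSup_nonneg ?_
  rintro d ⟨s, -, -, rfl⟩
  exact deltaFun_nonneg h0 h1 s l

/-- With `δ` close to `tauStar R l ω` and `ρ = (1 + ε) δ`, the loss `ε s δ` is at most `ε` times the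
upper bound of `gFun`, whatever the value of `s`. -/
theorem exists_tauStar_lt {R R' : ℝ} {l : ℕ} (hR : 0 ≤ R) (hR' : R' < R) (hl : 0 < l)
    (hT : 0 < tauStar R l ω) :
    ∃ s > 0, ∃ ρ > tauStar R l ω, R' * l * Real.log 2 < gFun s l ω - s * ρ := by
  have hlog : 0 < Real.log 2 := Real.log_pos one_lt_two
  set G := -Real.log (ω ^ (l + 1) + (1 - ω) ^ (l + 1))
  set η := (R - R') * l * Real.log 2 with hη
  have hη0 : 0 < η := by have := sub_pos.2 hR'; positivity
  set ε := η / (|G| + 1)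
  have hε : 0 < ε := by positivity
  have hne : {d : ℝ | ∃ s : ℝ, 0 < s ∧ R * l * Real.log 2 ≤ gFun s l ω - s * deltaFun s l ω ∧
      d = deltaFun s l ω}.Nonempty := by
    by_contra hempty
    rw [tauStar, Set.not_nonempty_iff_eq_empty.1 hempty, Real.sSup_empty] at hT
    exact hT.false
  obtain ⟨_, ⟨s, hs, hsR, rfl⟩, hd⟩ := exists_lt_of_lt_csSup hne
    (div_lt_self hT (lt_add_of_pos_right 1 hε))
  refine ⟨s, hs, (1 + ε) * deltaFun s l ω, by rwa [gt_iff_lt, ← div_lt_iff₀' (by positivity)], ?_⟩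
  have hsd : s * deltaFun s l ω ≤ |G| := by
    have : 0 ≤ R * l * Real.log 2 := by positivity
    linarith [gFun_le h0 h1 s l, le_abs_self G]
  have hloss : ε * (s * deltaFun s l ω) < η :=
    calc ε * (s * deltaFun s l ω) ≤ ε * |G| := by gcongr
      _ < ε * (|G| + 1) := by gcongr; exact lt_add_one _
      _ = η := div_mul_cancel₀ _ (by positivity)
  linarith

end TauStar

section FirstStage

/-- Among the `(l + 1)`-tuples of sets of size `⌊ω n⌋` in an `n`-set, those with more than
`⌊ω n⌋ - ρ n` common positions have a density of exponentially smaller order than `exp (-n r l)`, so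
that expurgation removes them from a random code of size `exp (n r)`. -/
def RareOverlaps (ω r : ℝ) (l : ℕ) (ρ : ℝ) : Prop :=
  ∃ c > 0, ∀ᶠ n : ℕ in atTop, (#(badTuples (Fin n) ⌊ω * n⌋₊ l (ρ * n)) : ℝ) ≤
    (n.choose ⌊ω * n⌋₊ : ℝ) ^ (l + 1) * Real.exp (-(n * (r * l + c)))

variable {ω r ρ : ℝ} {l : ℕ} (h0 : 0 ≤ ω) (h1 : ω ≤ 1)
include h0 h1

theorem rareOverlaps_of_lt_gFun {s : ℝ} (hs : 0 ≤ s) (h : r * l < gFun s l ω - s * ρ) :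
    RareOverlaps ω r l ρ := by
  obtain ⟨e, hre, heg⟩ := exists_between h
  refine ⟨e - r * l, sub_pos.2 hre, ?_⟩
  have hlim : Tendsto (fun n : ℕ => (l + 1) * (Real.log (n + 1) / n) +
      Real.log (partitionSum s l (⌊ω * n⌋₊ / n)) + s * ρ) atTop
      (𝓝 ((l + 1) * 0 + Real.log (partitionSum s l ω) + s * ρ)) :=
    ((tendsto_log_succ_div.const_mul _).add
      ((((continuous_partitionSum s l).tendsto ω).comp (tendsto_floor_mul_div h0)).log
        (partitionSum_pos h0 h1 s l).ne')).add_const _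
  have hev := hlim.eventually_lt_const (show _ < -e by rw [gFun] at heg; linarith)
  filter_upwards [hev, eventually_gt_atTop 0] with n hn hn0
  have : (0 : ℝ) < n := mod_cast hn0
  have hw := floor_mul_le h1 n
  set w := ⌊ω * n⌋₊
  have hZ := partitionSum_pos (by positivity : 0 ≤ (w : ℝ) / n)
    (div_le_one_of_le₀ (Nat.cast_le.2 hw) n.cast_nonneg) s l
  have hbad := card_badTuples_le (α := Fin n) (θ := ρ * n) (l := l) (by simpa using hw) hs
  rw [Fintype.card_fin, mul_comm ((n : ℝ) + 1), mul_pow, mul_assoc] at hbad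
  refine hbad.trans (mul_le_mul_of_nonneg_left ?_ (by positivity))
  rw [← Real.exp_log (by positivity : (0 : ℝ) < n + 1), ← Real.exp_log hZ, ← Real.exp_nat_mul,
    ← Real.exp_nat_mul, ← Real.exp_add, ← Real.exp_add, Real.exp_le_exp]
  calc _ = (n : ℝ) * ((l + 1) * (Real.log (n + 1) / n) + Real.log (partitionSum s l (w / n)) +
        s * ρ) := by push_cast; field_simp; ring
    _ ≤ n * -e := by gcongr
    _ = _ := by ring

omit h0 h1 in
theorem exists_binEntropy_lt {κ : ℝ} (hκ : 0 < κ) :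
    ∃ p > 0, p ≤ 1 / 2 ∧ Real.binEntropy p < κ := by
  have hlim : Tendsto Real.binEntropy (𝓝[>] 0) (𝓝 0) := by
    simpa using (Real.binEntropy_continuous.tendsto 0).mono_left nhdsWithin_le_nhds
  obtain ⟨p, hp, hp0, hp1⟩ := ((hlim.eventually_lt_const hκ).and
    (Ioc_mem_nhdsGT (by norm_num : (0 : ℝ) < 1 / 2))).exists
  exact ⟨p, hp0, hp1, hp⟩

theorem eventually_exp_le_choose (h : r < Real.binEntropy ω) :
    ∀ᶠ n : ℕ in atTop, Real.exp (n * r) ≤ n.choose ⌊ω * n⌋₊ := by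
  have hlim : Tendsto (fun n : ℕ => Real.binEntropy (⌊ω * n⌋₊ / n) - Real.log (n + 1) / n)
      atTop (𝓝 (Real.binEntropy ω - 0)) :=
    ((Real.binEntropy_continuous.tendsto ω).comp (tendsto_floor_mul_div h0)).sub
      tendsto_log_succ_div
  filter_upwards [hlim.eventually_const_lt (by linarith : r < _), eventually_gt_atTop 0]
    with n hn hn0
  have hn0 : (0 : ℝ) < n := mod_cast hn0
  set w := ⌊ω * n⌋₊
  refine le_of_mul_le_mul_left ?_ (by positivity : (0 : ℝ) < n + 1)
  calc (n + 1 : ℝ) * Real.exp (n * r)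
      = Real.exp (n * (Real.log (n + 1) / n + r)) := by
        rw [mul_add, mul_div_cancel₀ _ hn0.ne', Real.exp_add, Real.exp_log (by positivity)]
    _ ≤ Real.exp (n * Real.binEntropy (w / n)) := by
        gcongr
        linarith
    _ ≤ (n + 1) * n.choose w := exp_binEntropy_le_choose (floor_mul_le h1 n)

theorem exists_rareOverlaps_one (h : r < Real.binEntropy ω) :
    ∃ ρ > 0, RareOverlaps ω r 1 ρ := by
  set κ := (Real.binEntropy ω - r) / 3 with hκ
  have hκ0 : 0 < κ := div_pos (sub_pos.2 h) three_pos
  obtain ⟨p, hp0, hp1, hpκ⟩ := exists_binEntropy_lt hκ0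
  refine ⟨p / 2, half_pos hp0, κ, hκ0, ?_⟩
  filter_upwards [eventually_exp_le_choose h0 h1 (by linarith : r + κ + κ < Real.binEntropy ω)]
    with n hC
  set w := ⌊ω * n⌋₊
  have hpairs := card_badTuples_one_le (α := Fin n) (w := w) (θ := p / 2 * n)
  have hball : (#{S : Finset (Fin n) | #S ≤ ⌊2 * (p / 2 * n)⌋₊} : ℝ) ≤ Real.exp (n * κ) := by
    have hle : (⌊2 * (p / 2 * n)⌋₊ : ℝ) ≤ p * n :=
      (Nat.floor_le (by positivity)).trans_eq (by ring)
    refine (card_filter_card_le_exp_binEntropy hp0 hp1 (by simpa using hle)).trans ?_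
    rw [Fintype.card_fin]
    gcongr
  rw [Fintype.card_fin] at hpairs
  calc (#(badTuples (Fin n) w 1 (p / 2 * n)) : ℝ)
      ≤ n.choose w * #{S : Finset (Fin n) | #S ≤ ⌊2 * (p / 2 * n)⌋₊} := mod_cast hpairs
    _ ≤ n.choose w * Real.exp (n * κ) := by gcongr
    _ = n.choose w * (Real.exp (n * (r + κ + κ)) * Real.exp (-(n * (r + κ)))) := by
        rw [← Real.exp_add]
        congr 2
        ring
    _ ≤ n.choose w * (n.choose w * Real.exp (-(n * (r + κ)))) := by gcongr
    _ = _ := by push_cast; ring_nf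

theorem exists_rareOverlaps {R R' : ℝ} (hR : 0 ≤ R) (hR' : R' < R) (hRω : R ≤ entropy ω)
    (hl : 0 < l) :
    ∃ k ∈ Icc 1 l, ∃ ρ > tauStar R l ω, RareOverlaps ω (R' * Real.log 2) k ρ := by
  have hlog : 0 < Real.log 2 := Real.log_pos one_lt_two
  rcases (tauStar_nonneg h0 h1 R l).eq_or_lt with hT | hT
  · obtain ⟨ρ, hρ, hrare⟩ := exists_rareOverlaps_one h0 h1 <|
      (mul_lt_mul_of_pos_right hR' hlog).trans_le ((le_div_iff₀ hlog).1 hRω)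
    exact ⟨1, left_mem_Icc.2 hl, ρ, hT ▸ hρ, hrare⟩
  · obtain ⟨s, hs, ρ, hρ, hlt⟩ := exists_tauStar_lt h0 h1 hR hR' hl hT
    exact ⟨l, right_mem_Icc.2 hl, ρ, hρ,
      rareOverlaps_of_lt_gFun h0 h1 hs.le (by linarith)⟩

omit h0 h1 in
theorem sum_pow_mul_le {K : Type*} {I : Finset K} {k : K → ℕ} {c q : K → ℝ} {n M : ℕ}
    (hM : (M : ℝ) ≤ 4 * Real.exp (n * r))
    (hq : ∀ i ∈ I, q i ≤ Real.exp (-(n * (r * k i + c i))))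
    (hsmall : ∑ i ∈ I, (4 : ℝ) ^ k i * Real.exp (-(n * c i)) ≤ 1 / 2) :
    ∑ i ∈ I, (M : ℝ) ^ (k i + 1) * q i ≤ M / 2 :=
  calc ∑ i ∈ I, (M : ℝ) ^ (k i + 1) * q i
      ≤ ∑ i ∈ I, M * ((4 : ℝ) ^ k i * Real.exp (-(n * c i))) := by
        refine sum_le_sum fun i hi => ?_
        calc (M : ℝ) ^ (k i + 1) * q i
            = M * (M ^ k i * q i) := by ring
          _ ≤ M * (M ^ k i * Real.exp (-(n * (r * k i + c i)))) := by
              gcongr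
              exact hq i hi
          _ ≤ M * ((4 * Real.exp (n * r)) ^ k i * Real.exp (-(n * (r * k i + c i)))) := by
              gcongr
          _ = M * (4 ^ k i * Real.exp (-(n * c i))) := by
              rw [mul_pow, ← Real.exp_nat_mul, mul_assoc, ← Real.exp_add]
              congr 4
              ring
    _ = M * ∑ i ∈ I, (4 : ℝ) ^ k i * Real.exp (-(n * c i)) := by rw [mul_sum]
    _ ≤ M * (1 / 2) := by gcongr
    _ = M / 2 := by ring

omit h0 in
theorem eventually_exists_spread_code {K : Type*} {I : Finset K} {k : K → ℕ} {ρ : K → ℝ} {i₀ : K}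
    (hi₀ : i₀ ∈ I) (hk : k i₀ = 1) (hρ : 0 < ρ i₀) (hr : 0 ≤ r)
    (hrare : ∀ i ∈ I, RareOverlaps ω r (k i) (ρ i)) :
    ∀ᶠ n : ℕ in atTop, ∃ C : Finset (Finset (Fin n)), (∀ A ∈ C, #A = ⌊ω * n⌋₊) ∧
      Real.exp (n * r) ≤ #C ∧ ∀ i ∈ I, Spread C ⌊ω * n⌋₊ (k i) (ρ i * n) := by
  choose! c hc hbad using hrare
  have hsmall : Tendsto (fun n : ℕ => ∑ i ∈ I, (4 : ℝ) ^ k i * Real.exp (-(n * c i))) atTop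
      (𝓝 (∑ i ∈ I, (4 : ℝ) ^ k i * 0)) :=
    tendsto_finsetSum _ fun i hi => (Real.tendsto_exp_neg_atTop_nhds_zero.comp
      (tendsto_natCast_atTop_atTop.atTop_mul_const (hc i hi))).const_mul _
  filter_upwards [hsmall.eventually_le_const (by simp : _ < (1 / 2 : ℝ)),
    (eventually_all_finset I).2 hbad, eventually_gt_atTop 0] with n hn hbad hn0
  have hw := floor_mul_le h1 n
  set w := ⌊ω * n⌋₊
  set E := Real.exp (n * r)
  have hE : 1 ≤ E := Real.one_le_exp (by positivity)
  have hM : ((2 * ⌈E⌉₊ : ℕ) : ℝ) ≤ 4 * E := by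
    push_cast
    linarith [(Nat.ceil_lt_add_one (zero_le_one.trans hE)).le]
  have hchoose : (0 : ℝ) < n.choose w := mod_cast Nat.choose_pos hw
  obtain ⟨C, hCw, hMC, hspread⟩ := exists_spread_code (α := Fin n) (w := w) (by simpa using hw)
    (2 * ⌈E⌉₊) (θ := fun i => ρ i * n) hi₀ hk (by positivity) <| by
      rw [Fintype.card_fin]
      exact sum_pow_mul_le hM
        (fun i hi => (div_le_iff₀' (by positivity)).2 (hbad i hi)) hn
  refine ⟨C, hCw, le_trans ?_ hMC, hspread⟩
  push_cast
  linarith [Nat.le_ceil E]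

theorem exists_firstStage {R R' : ℝ} {Lup : ℕ} (hLup : 0 < Lup)
    (hR'0 : 0 ≤ R') (hR' : R' < R) (hR : R ≤ entropy ω) :
    ∃ ρ : ℕ → ℝ, (∀ l ∈ Icc 1 Lup, tauStar R l ω < ρ l) ∧ ∀ᶠ n : ℕ in atTop,
      ∃ C : Finset (Finset (Fin n)), (∀ A ∈ C, #A = ⌊ω * n⌋₊) ∧
        Real.exp (n * (R' * Real.log 2)) ≤ #C ∧
        ∀ l ∈ Icc 1 Lup, Spread C ⌊ω * n⌋₊ l (ρ l * n) := by
  choose! k hk ρ hρ hrare using fun l (hl : l ∈ Icc 1 Lup) =>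
    exists_rareOverlaps h0 h1 (hR'0.trans hR'.le) hR' hR (mem_Icc.1 hl).1
  have hone : 1 ∈ Icc 1 Lup := left_mem_Icc.2 hLup
  have hk1 : k 1 = 1 := by simpa using hk 1 hone
  refine ⟨ρ, hρ, ?_⟩
  filter_upwards [eventually_exists_spread_code h1 hone hk1
    ((tauStar_nonneg h0 h1 R 1).trans_lt (hρ 1 hone))
    (mul_nonneg hR'0 (Real.log_nonneg one_le_two)) hrare] with n ⟨C, hCw, hC, hspread⟩
  exact ⟨C, hCw, hC, fun l hl => (hspread l hl).mono (mem_Icc.1 (hk l hl)).2⟩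

end FirstStage

section TwoStage

variable {n n₁ n₂ t w K r : ℕ}

/-- The set of positions of the ones of a binary word. -/
def support (x : Fin n → Bool) : Finset (Fin n) := {i | x i = true}

/-- The indicator word of a set of positions. -/
def word (A : Finset (Fin n)) : Fin n → Bool := fun i => decide (i ∈ A)

theorem support_word (A : Finset (Fin n)) : support (word A) = A := by
  ext; simp [support, word]

theorem Delta_eq_card_sdiff (x y : Fin n → Bool) : Delta x y = #(support x \ support y) := by
  rw [Delta]; congr 1; ext; simp [support]

theorem mem_outputs {M : ℕ} {f : Fin M → Fin n₁ → Bool}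
    {g : Fin M → (Fin n₁ → Bool) → Fin n₂ → Bool} {m : Fin M}
    {y : (Fin n₁ → Bool) × (Fin n₂ → Bool)} :
    y ∈ outputs f g t m ↔ support y.1 ⊆ support (f m) ∧ support y.2 ⊆ support (g m y.1) ∧
      #(support (f m) \ support y.1) + #(support (g m y.1) \ support y.2) ≤ t := by
  simp [outputs, Delta_eq_card_sdiff]

theorem twoStageAchievable_of_eq_of_mem_outputs {M : ℕ} [NeZero M] (f : Fin M → Fin n₁ → Bool)
    (g : Fin M → (Fin n₁ → Bool) → Fin n₂ → Bool)
    (h : ∀ m m' y, y ∈ outputs f g t m → y ∈ outputs f g t m' → m = m') :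
    TwoStageAchievable n₁ n₂ t M :=
  ⟨f, g, fun y => Classical.epsilon fun m => y ∈ outputs f g t m, fun m y hy =>
    h _ m y (Classical.epsilon_spec (p := fun m => y ∈ outputs f g t m) ⟨m, hy⟩) hy⟩

theorem HasCode.exists_encoder (h : HasCode n K r) {β : Type*} {S : Finset β} (hS : #S ≤ K) :
    ∃ enc : β → Finset (Fin n),
      (S : Set β).Pairwise fun a b => r < max #(enc a \ enc b) #(enc b \ enc a) := by
  classical
  obtain ⟨C, hK, hC⟩ := h
  obtain ⟨e⟩ : Nonempty (S ↪ C) :=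
    Function.Embedding.nonempty_of_card_le (by simpa using hS.trans hK)
  refine ⟨fun a => if ha : a ∈ S then e ⟨a, ha⟩ else ∅, fun a ha b hb hab => ?_⟩
  simp only [mem_coe.1 ha, mem_coe.1 hb, dif_pos]
  exact hC (e _).2 (e _).2 fun h => hab (congrArg Subtype.val (e.injective (Subtype.ext h)))

theorem exists_secondStage_encoder (C : Finset (Finset (Fin n₁)))
    (h : ∀ Y : Finset (Fin n₁), #Y ≤ w → w - #Y ≤ t →
      HasCode n₂ #{A ∈ C | Y ⊆ A} (t - (w - #Y))) :
    ∃ enc : Finset (Fin n₁) → Finset (Fin n₁) → Finset (Fin n₂), ∀ Y, #Y ≤ w → w - #Y ≤ t →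
      ∀ A ∈ C, ∀ B ∈ C, Y ⊆ A → Y ⊆ B → A ≠ B →
        t - (w - #Y) < max #(enc Y A \ enc Y B) #(enc Y B \ enc Y A) := by
  choose enc henc using fun Y (hY : #Y ≤ w) (ht : w - #Y ≤ t) =>
    (h Y hY ht).exists_encoder (S := {A ∈ C | Y ⊆ A}) le_rfl
  refine ⟨fun Y => if hY : #Y ≤ w ∧ w - #Y ≤ t then enc Y hY.1 hY.2 else fun _ => ∅,
    fun Y hY ht A hA B hB hYA hYB hAB => ?_⟩
  simp only [hY, ht, and_self, dif_pos]
  exact henc Y hY ht (by simp [hA, hYA]) (by simp [hB, hYB]) hAB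

theorem twoStageAchievable_of_hasCode {C : Finset (Finset (Fin n₁))} (hw : ∀ A ∈ C, #A = w)
    (hne : C.Nonempty) (h : ∀ Y : Finset (Fin n₁), #Y ≤ w → w - #Y ≤ t →
      HasCode n₂ #{A ∈ C | Y ⊆ A} (t - (w - #Y))) :
    TwoStageAchievable n₁ n₂ t #C := by
  obtain ⟨enc, henc⟩ := exists_secondStage_encoder C h
  have : NeZero #C := ⟨hne.card_pos.ne'⟩
  let e : Fin #C ≃ C := C.equivFin.symm
  refine twoStageAchievable_of_eq_of_mem_outputs (fun m => word (e m).1)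
    (fun m y => word (enc (support y) (e m).1)) fun m m' y hm hm' => ?_
  simp only [mem_outputs, support_word] at hm hm'
  obtain ⟨hYA, hZA, hA⟩ := hm
  obtain ⟨hYB, hZB, hB⟩ := hm'
  by_contra hne
  have hAcard := hw _ (e m).2
  rw [card_sdiff_of_subset hYA, hAcard] at hA
  rw [card_sdiff_of_subset hYB, hw _ (e m').2] at hB
  have hsep := henc _ (hAcard ▸ card_le_card hYA) (by omega) _ (e m).2 _ (e m').2 hYA hYB
    fun h => hne (e.injective (Subtype.ext h))
  have hsdiffA := card_le_card (sdiff_subset_sdiff (Subset.refl (enc (support y.1) (e m).1)) hZB)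
  have hsdiffB := card_le_card (sdiff_subset_sdiff (Subset.refl (enc (support y.1) (e m').1)) hZA)
  rcases lt_max_iff.1 hsep with h | h <;> omega

end TwoStage

section List

variable {α : Type*} [Fintype α] [DecidableEq α] {C : Finset (Finset α)} {w l m : ℕ} {θ : ℝ}
  {Y : Finset α}

theorem Spread.card_list_le (h : Spread C w l θ) (hY : (w : ℝ) < #Y + θ) :
    #{A ∈ C | Y ⊆ A} ≤ l := by
  by_contra! hlt
  obtain ⟨e⟩ : Nonempty (Fin (l + 1) ↪ ({A ∈ C | Y ⊆ A} : Finset (Finset α))) :=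
    Function.Embedding.nonempty_of_card_le (by rw [Fintype.card_fin, Fintype.card_coe]; exact hlt)
  have hmem := fun j => mem_filter.1 (e j).2
  have hle := h (fun j => (e j).1) (Subtype.val_injective.comp e.injective) fun j => (hmem j).1
  have hYle : #Y ≤ overlap fun j => (e j).1 := by
    unfold overlap
    refine card_le_card fun i hi => ?_
    simpa using fun j => (hmem j).2 hi
  have : (#Y : ℝ) ≤ overlap fun j => (e j).1 := mod_cast hYle
  linarith

theorem Spread.le_card_sdiff (h : Spread C w 1 θ) {A B : Finset α} (hA : A ∈ C) (hAw : #A = w)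
    (hB : B ∈ C) (hAB : A ≠ B) : θ ≤ #(A \ B) := by
  have hle := h ![A, B]
    (by simpa [Function.Injective, Fin.forall_fin_two, eq_comm] using hAB)
    (by simpa [Fin.forall_fin_two] using ⟨hA, hB⟩)
  have hover : overlap ![A, B] = #(A ∩ B) := by
    rw [overlap]; congr 1; ext; simp [Fin.forall_fin_two]
  have hcard : (#(A \ B) : ℝ) + #(A ∩ B) = w := mod_cast hAw ▸ card_sdiff_add_card_inter A B
  rw [hover] at hle
  linarith

/-- The codewords containing `Y` form a constant-weight code with the same asymmetric distance on
the positions outside `Y`. -/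
theorem Spread.card_list_mul_choose_le (h : Spread C w 1 θ) (hw : ∀ A ∈ C, #A = w)
    (hmN : 2 * m ≤ #Yᶜ) (hm : (m : ℝ) * (#Yᶜ - m) < θ * #Yᶜ) :
    #{A ∈ C | Y ⊆ A} * (#Yᶜ).choose m ≤
      (#Yᶜ + 1) ^ 3 * max ((#Yᶜ).choose (w - #Y)) ((#Yᶜ).choose m) := by
  have hN : Fintype.card {i // i ∈ Yᶜ} = #Yᶜ := Fintype.card_coe _
  let f (A : Finset α) : Finset {i // i ∈ Yᶜ} := A.subtype (· ∈ Yᶜ)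
  have hcard : ∀ A, #(f A) = #(A \ Y) := fun A => by
    simp only [f, card_subtype, mem_compl, filter_notMem_eq_sdiff]
  have hinj : Set.InjOn f ({A ∈ C | Y ⊆ A} : Finset _) := by
    intro A hA B hB hAB
    ext i
    by_cases hi : i ∈ Y
    · exact iff_of_true ((mem_filter.1 hA).2 hi) ((mem_filter.1 hB).2 hi)
    · simpa [f] using Finset.ext_iff.1 hAB ⟨i, mem_compl.2 hi⟩
  have hdist : ((({A ∈ C | Y ⊆ A} : Finset (Finset α)).image f : Finset (Finset {i // i ∈ Yᶜ})) :
      Set (Finset {i // i ∈ Yᶜ})).Pairwise fun A B =>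
      ⌈θ⌉₊ ≤ #(A \ B) := by
    rw [coe_image]
    refine hinj.pairwise_image.2 fun A hA B hB hAB => Nat.ceil_le.2 ?_
    have hA := mem_filter.1 hA
    have hB := mem_filter.1 hB
    have hsdiff : f A \ f B = f (A \ B) := by ext; simp [f]
    have hdisj : (A \ B) \ Y = A \ B :=
      sdiff_eq_self_of_disjoint (disjoint_sdiff_self_left.mono_right hB.2)
    rw [hsdiff, hcard, hdisj]
    exact h.le_card_sdiff hA.1 (hw A hA.1) hB.1 hAB
  rw [← card_image_of_injOn hinj, ← hN]
  refine card_mul_choose_le_max (fun S hS => ?_) hdist (by rwa [hN]) ?_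
  · obtain ⟨A, hA, rfl⟩ := mem_image.1 hS
    rw [hcard, card_sdiff_of_subset (mem_filter.1 hA).2, hw A (mem_filter.1 hA).1]
  · rw [hN]
    have hceil : θ * #Yᶜ ≤ ⌈θ⌉₊ * #Yᶜ := by gcongr; exact Nat.le_ceil θ
    exact mod_cast hm.trans_le hceil

theorem Spread.card_list_le_exp (h : Spread C w 1 θ) (hw : ∀ A ∈ C, #A = w) (hk : w - #Y ≤ #Yᶜ)
    (hmN : 2 * m ≤ #Yᶜ) (hm : (m : ℝ) * (#Yᶜ - m) < θ * #Yᶜ) :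
    (#{A ∈ C | Y ⊆ A} : ℝ) ≤ (#Yᶜ + 1 : ℝ) ^ 4 * Real.exp (#Yᶜ *
      max 0 (Real.binEntropy ((w - #Y : ℕ) / #Yᶜ) - Real.binEntropy (m / #Yᶜ))) := by
  have hlist := h.card_list_mul_choose_le hw hmN hm
  set N := #Yᶜ
  set F := #{A ∈ C | Y ⊆ A}
  set a := Real.binEntropy ((w - #Y : ℕ) / N)
  set b := Real.binEntropy (m / N)
  have hlist : (F : ℝ) * N.choose m ≤ (N + 1 : ℝ) ^ 3 * max (N.choose (w - #Y) : ℝ) (N.choose m) :=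
    mod_cast hlist
  have hmax : max (N.choose (w - #Y) : ℝ) (N.choose m) ≤
      Real.exp (N * b) * Real.exp (N * max 0 (a - b)) := by
    rw [← Real.exp_add, ← mul_add]
    refine max_le ((choose_le_exp_binEntropy hk).trans ?_)
      ((choose_le_exp_binEntropy (by omega)).trans ?_) <;> gcongr
    · linarith [le_max_right 0 (a - b)]
    · linarith [le_max_left 0 (a - b)]
  refine le_of_mul_le_mul_right ?_ (Real.exp_pos (N * b))
  calc (F : ℝ) * Real.exp (N * b) ≤ F * ((N + 1) * N.choose m) := by
        gcongr
        exact exp_binEntropy_le_choose (by omega)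
    _ = (N + 1) * (F * N.choose m) := by ring
    _ ≤ (N + 1) * ((N + 1 : ℝ) ^ 3 * (Real.exp (N * b) * Real.exp (N * max 0 (a - b)))) :=
        mul_le_mul_of_nonneg_left (hlist.trans (by gcongr)) (by positivity)
    _ = _ := by ring

end List

section Asymptotic

variable {ι : Type*} {F : Filter ι} {n r : ι → ℕ} {y κ : ℝ}

theorem exists_hasCode_of_lt_maxFraction {K : ℕ} (hy : (y : EReal) < maxFraction K) :
    ∃ n₀ > 0, ∃ r₀, HasCode n₀ K r₀ ∧ y * n₀ < r₀ + 1 := by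
  obtain ⟨δ, hδ⟩ := lt_iSup_iff.1 hy
  obtain ⟨⟨hδ0, n₀, hn₀, C, hC, hdist⟩, hyδ⟩ := lt_iSup_iff.1 hδ
  have hceil : ⌈n₀ * δ⌉₊ - 1 + 1 = ⌈n₀ * δ⌉₊ := Nat.sub_add_cancel (Nat.ceil_pos.2 (by positivity))
  refine ⟨n₀, hn₀, ⌈n₀ * δ⌉₊ - 1,
    HasCode.of_image (f := support) hC.ge fun x hx z hz hxz => ?_, ?_⟩
  · have hxz := hdist x hx z hz hxz
    rw [asymDist, Delta_eq_card_sdiff, Delta_eq_card_sdiff, Nat.cast_mul, Nat.cast_two] at hxz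
    exact Nat.lt_of_succ_le (hceil.trans_le (Nat.ceil_le.2 (by linarith)))
  · calc y * n₀ < δ * n₀ := by gcongr; exact EReal.coe_lt_coe_iff.1 hyδ
      _ = n₀ * δ := mul_comm _ _
      _ ≤ ⌈n₀ * δ⌉₊ := Nat.le_ceil _
      _ = _ := by rw [← hceil]; push_cast; ring

theorem eventually_hasCode_of_lt_maxFraction {K : ℕ} (hy : (y : EReal) < maxFraction K)
    (hn : Tendsto n F atTop) (hr : Tendsto (fun j => (r j : ℝ) / n j) F (𝓝 y)) :
    ∀ᶠ j in F, HasCode (n j) K (r j) := by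
  obtain ⟨n₀, hn₀, r₀, hcode, hyr⟩ := exists_hasCode_of_lt_maxFraction hy
  have hcopies : Tendsto (fun j => ((n j / n₀ : ℕ) : ℝ) / n j) F (𝓝 (n₀ : ℝ)⁻¹) := by
    refine ((tendsto_floor_mul_div (ω := (n₀ : ℝ)⁻¹) (by positivity)).comp hn).congr fun j => ?_
    rw [Function.comp_apply, inv_mul_eq_div, Nat.floor_div_eq_div]
  have hlt : y < (n₀ : ℝ)⁻¹ * (r₀ + 1) := by
    rwa [inv_mul_eq_div, lt_div_iff₀ (by positivity)]
  filter_upwards [hr.eventually_lt (hcopies.mul_const ((r₀ : ℝ) + 1)) hlt,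
    hn.eventually_gt_atTop 0] with j hj hj0
  refine hcode.repetition (q := n j / n₀) (Nat.div_mul_le_self _ _) ?_
  rw [div_mul_eq_mul_div, div_lt_div_iff_of_pos_right (by positivity)] at hj
  exact_mod_cast hj

theorem eventually_hasCode_of_lt_log_two_sub (hy0 : 0 ≤ y) (hy : y < 1 / 4)
    (hκ : κ < Real.log 2 - Real.binEntropy (2 * y)) (hn : Tendsto n F atTop)
    (hr : Tendsto (fun j => (r j : ℝ) / n j) F (𝓝 y)) :
    ∀ᶠ j in F, ∀ K : ℕ, (K : ℝ) ≤ Real.exp (n j * κ) → HasCode (n j) K (r j) := by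
  have hcont : Continuous fun p => Real.log 2 - Real.binEntropy p := by fun_prop
  obtain ⟨p, hpκ, hyp, hp⟩ := (((hcont.tendsto (2 * y)).mono_left nhdsWithin_le_nhds
    |>.eventually_const_lt hκ).and (Ioc_mem_nhdsGT (by linarith : 2 * y < 1 / 2))).exists
  filter_upwards [hr.eventually_lt_const (by linarith : y < p / 2), hn.eventually_gt_atTop 0]
    with j hj hj0 K hK
  rw [div_lt_iff₀ (by positivity)] at hj
  refine hasCode_of_le_exp (by linarith) hp (by linarith) (hK.trans ?_)
  gcongr

theorem binEntropy_two_mul_lt_log_two (hy : y < 1 / 4) :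
    Real.binEntropy (2 * y) < Real.log 2 := by
  rw [Real.binEntropy_lt_log_two]
  linarith

theorem eventually_hasCode_of_lt_quarter (K : ℕ) (hy0 : 0 ≤ y) (hy : y < 1 / 4)
    (hn : Tendsto n F atTop) (hr : Tendsto (fun j => (r j : ℝ) / n j) F (𝓝 y)) :
    ∀ᶠ j in F, HasCode (n j) K (r j) := by
  obtain ⟨κ, hκ0, hκ⟩ := exists_between (sub_pos.2 (binEntropy_two_mul_lt_log_two hy))
  have hexp : Tendsto (fun j => Real.exp (n j * κ)) F atTop :=
    Real.tendsto_exp_atTop.comp ((tendsto_natCast_atTop_atTop.comp hn).atTop_mul_const hκ0)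
  filter_upwards [eventually_hasCode_of_lt_log_two_sub hy0 hy hκ hn hr,
    hexp.eventually_ge_atTop (K : ℝ)] with j hcode hK
  exact hcode K hK

end Asymptotic

section TauStarHalf

theorem partitionSum_one_half (s : ℝ) :
    partitionSum s 1 (1 / 2) = (1 + Real.exp (-(s / 2))) / 2 := by
  have hexp : -(s * 1 / (1 + 1)) = -(s / 2) := by ring
  simp only [partitionSum, Icc_self, sum_singleton, Nat.cast_one, hexp]
  norm_num
  ring

theorem deltaFun_one_half (s : ℝ) :
    deltaFun s 1 (1 / 2) = Real.exp (-(s / 2)) / (1 + Real.exp (-(s / 2))) / 2 := by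
  have hexp : -(s * 1 / (1 + 1)) = -(s / 2) := by ring
  rw [deltaFun, partitionSum_one_half]
  simp only [Icc_self, sum_singleton, Nat.cast_one, hexp]
  norm_num
  field_simp

theorem gFun_sub_mul_deltaFun_one_half (s : ℝ) : gFun s 1 (1 / 2) - s * deltaFun s 1 (1 / 2) =
    Real.log 2 - Real.binEntropy (2 * deltaFun s 1 (1 / 2)) := by
  rw [gFun, deltaFun_one_half, partitionSum_one_half]
  set u := Real.exp (-(s / 2)) with hu
  have hu0 : 0 < u := Real.exp_pos _
  have hs : s = -2 * Real.log u := by rw [hu, Real.log_exp]; ring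
  have hcompl : 1 - u / (1 + u) = 1 / (1 + u) := by field_simp; ring
  rw [mul_div_cancel₀ _ two_ne_zero, Real.binEntropy, hcompl, Real.log_inv, Real.log_inv,
    Real.log_div hu0.ne' (by positivity), Real.log_div one_ne_zero (by positivity),
    Real.log_div (by positivity) two_ne_zero, Real.log_one, hs]
  field_simp
  ring

theorem deltaFun_one_half_lt_quarter {s : ℝ} (hs : 0 < s) : deltaFun s 1 (1 / 2) < 1 / 4 := by
  have hexp : Real.exp (-(s / 2)) < 1 := by simpa using hs
  rw [deltaFun_one_half, div_div, div_lt_div_iff₀ (by positivity) (by norm_num)]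
  linarith

theorem tauStar_one_half_le_quarter (R : ℝ) : tauStar R 1 (1 / 2) ≤ 1 / 4 := by
  refine Real.sSup_le ?_ (by norm_num)
  rintro d ⟨s, hs, -, rfl⟩
  exact (deltaFun_one_half_lt_quarter hs).le

theorem binEntropy_two_mul_tauStar_le {R : ℝ} (hpos : 0 < tauStar R 1 (1 / 2)) :
    Real.binEntropy (2 * tauStar R 1 (1 / 2)) ≤ (1 - R) * Real.log 2 := by
  rw [tauStar] at hpos ⊢
  set S : Set ℝ := {d | ∃ s : ℝ, 0 < s ∧ R * (1 : ℕ) * Real.log 2 ≤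
    gFun s 1 (1 / 2) - s * deltaFun s 1 (1 / 2) ∧ d = deltaFun s 1 (1 / 2)}
  have hne : S.Nonempty := by
    refine Set.nonempty_iff_ne_empty.2 fun hempty => hpos.ne' ?_
    rw [hempty, Real.sSup_empty]
  have hbdd : BddAbove S := by
    refine ⟨1 / 4, ?_⟩
    rintro d ⟨s, hs, -, rfl⟩
    exact (deltaFun_one_half_lt_quarter hs).le
  have hclosed : IsClosed {d : ℝ | Real.binEntropy (2 * d) ≤ (1 - R) * Real.log 2} :=
    isClosed_le (by fun_prop) continuous_const
  refine closure_minimal ?_ hclosed (csSup_mem_closure hne hbdd)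
  rintro d ⟨s, -, hR, rfl⟩
  rw [gFun_sub_mul_deltaFun_one_half, Nat.cast_one, mul_one] at hR
  rw [Set.mem_ofPred_eq]
  linarith

theorem binEntropy_two_mul_le_of_le_tauStar {R y : ℝ} (hy0 : 0 < y)
    (hy : y ≤ tauStar R 1 (1 / 2)) : Real.binEntropy (2 * y) ≤ (1 - R) * Real.log 2 := by
  have hquarter := tauStar_one_half_le_quarter R
  refine le_trans ?_ (binEntropy_two_mul_tauStar_le (hy0.trans_le hy))
  exact Real.binEntropy_strictMonoOn.monotoneOn ⟨by linarith, by norm_num; linarith⟩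
    ⟨by linarith, by norm_num; linarith⟩ (by linarith)

end TauStarHalf

section JohnsonRadius

variable {T T' ν : ℝ}

/-- The fraction of ones below which, in length `N`, the Johnson bound controls constant-weight
codes whose words differ pairwise in at least `T * N / ν` ones: the smaller root of
`r * (1 - r) = T / ν`, or `1 / 2` when there is no real root. -/
noncomputable def johnsonRadius (T ν : ℝ) : ℝ := (1 - √(1 - 4 * T / ν)) / 2

theorem johnsonRadius_le_half (T ν : ℝ) : johnsonRadius T ν ≤ 1 / 2 := by
  have := Real.sqrt_nonneg (1 - 4 * T / ν)
  rw [johnsonRadius]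
  linarith

theorem johnsonRadius_nonneg (hT : 0 ≤ T) (hν : 0 ≤ ν) : 0 ≤ johnsonRadius T ν := by
  have : 0 ≤ 4 * T / ν := by positivity
  have : √(1 - 4 * T / ν) ≤ 1 := Real.sqrt_le_one.2 (by linarith)
  rw [johnsonRadius]
  linarith

theorem johnsonRadius_mul_one_sub_le (T ν : ℝ) :
    johnsonRadius T ν * (1 - johnsonRadius T ν) ≤ T / ν := by
  have hsq : 1 - 4 * T / ν ≤ √(1 - 4 * T / ν) ^ 2 := by
    rw [Real.sq_sqrt']
    exact le_max_left _ _
  calc johnsonRadius T ν * (1 - johnsonRadius T ν) = (1 - √(1 - 4 * T / ν) ^ 2) / 4 := by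
        rw [johnsonRadius]; ring
    _ ≤ (1 - (1 - 4 * T / ν)) / 4 := by gcongr
    _ = T / ν := by ring

theorem binEntropy_johnsonRadius_lt (hT : 0 ≤ T) (hTT' : T < T') (hν : 0 < ν)
    (h : johnsonRadius T' ν ≠ 1 / 2) :
    Real.binEntropy (johnsonRadius T ν) < Real.binEntropy (johnsonRadius T' ν) := by
  have hdisc : 0 < 1 - 4 * T' / ν := by
    by_contra! hneg
    exact h (by rw [johnsonRadius, Real.sqrt_eq_zero_of_nonpos hneg, sub_zero])
  have hsqrt : √(1 - 4 * T' / ν) < √(1 - 4 * T / ν) := Real.sqrt_lt_sqrt hdisc.le (by gcongr)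
  refine Real.binEntropy_strictMonoOn ⟨johnsonRadius_nonneg hT hν.le, ?_⟩
    ⟨johnsonRadius_nonneg (hT.trans hTT'.le) hν.le, ?_⟩ ?_
  · simpa using johnsonRadius_le_half T ν
  · simpa using johnsonRadius_le_half T' ν
  · rw [johnsonRadius, johnsonRadius]
    linarith

theorem binEntropy_sub_johnsonRadius_lt (p : ℝ) (hT : 0 ≤ T) (hTT' : T < T') (hν : 0 < ν)
    (h : 0 < Real.binEntropy p - Real.binEntropy (johnsonRadius T' ν)) :
    Real.binEntropy p - Real.binEntropy (johnsonRadius T' ν) <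
      Real.binEntropy p - Real.binEntropy (johnsonRadius T ν) := by
  have hhalf : johnsonRadius T' ν ≠ 1 / 2 := by
    intro hhalf
    rw [hhalf, one_div, Real.binEntropy_two_inv] at h
    linarith [Real.binEntropy_le_log_two (p := p)]
  gcongr
  exact binEntropy_johnsonRadius_lt hT hTT' hν hhalf

end JohnsonRadius

section Residual

variable {τ α x : ℝ}

/-- The fraction of second-stage positions which may still be corrupted when a fraction `x` of the
first-stage positions has been. -/
noncomputable def residual (τ α x : ℝ) : ℝ := (τ - α * x) / (1 - α)

theorem residual_strictAnti (h0 : 0 < α) (h1 : α < 1) : StrictAnti (residual τ α) := fun x y h => by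
  have : 0 < 1 - α := sub_pos.2 h1
  unfold residual
  gcongr

theorem continuous_residual (τ α : ℝ) : Continuous (residual τ α) := by
  unfold residual
  fun_prop

theorem residual_pos (h1 : α < 1) (hx : α * x < τ) : 0 < residual τ α x :=
  div_pos (sub_pos.2 hx) (sub_pos.2 h1)

end Residual

section SecondRate

variable {α ω R x : ℝ}

theorem one_sub_mul_secondRate_mul_log_two (h1 : α < 1) :
    (1 - α) * (secondRate α x ω R * Real.log 2) =
      α * ((1 - ω + x) * (Real.binEntropy (x / (1 - ω + x)) -
        Real.binEntropy (johnsonRadius (tauStar R 1 ω) (1 - ω + x)))) := by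
  have : 1 - α ≠ 0 := (sub_pos.2 h1).ne'
  have : Real.log 2 ≠ 0 := (Real.log_pos one_lt_two).ne'
  rw [secondRate, entropy, entropy, johnsonRadius]
  field_simp

theorem continuousAt_secondRate (hν : 1 - ω + x ≠ 0) :
    ContinuousAt (fun x => secondRate α x ω R) x := by
  unfold secondRate entropy
  fun_prop (disch := exact hν)

end SecondRate

theorem maxFraction_antitone : Antitone maxFraction := by
  intro K K' h
  refine iSup₂_le fun δ ⟨hδ0, n, hn, C, hC, hdist⟩ => ?_
  obtain ⟨C', hC', hcard⟩ := exists_subset_card_eq (h.trans hC.ge)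
  exact le_iSup₂_of_le δ
    ⟨hδ0, n, hn, C', hcard, fun x hx y hy => hdist x (hC' hx) y (hC' hy)⟩ le_rfl

theorem exists_le_lt_or_le {β : Type*} [LinearOrder β] {f : ℕ → β} {a b : ℕ} {x : β} (hab : a ≤ b)
    (ha : f a ≤ x) : (∃ l ∈ Ico a b, f l ≤ x ∧ x < f (l + 1)) ∨ f b ≤ x := by
  induction b, hab using Nat.le_induction with
  | base => exact .inr ha
  | succ b hab ih =>
    rcases ih with ⟨l, hl, hlx⟩ | hb
    · exact .inl ⟨l, Ico_subset_Ico_right b.le_succ hl, hlx⟩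
    · exact (le_or_gt (f (b + 1)) x).symm.imp_left fun hbx =>
        ⟨b, mem_Ico.2 ⟨hab, b.lt_succ_self⟩, hb, hbx⟩

section Admissible

variable {τ ω α R x T : ℝ} {Lup l : ℕ}

theorem Admissible.residual_le (hadm : Admissible τ Lup ω α R) (hx0 : 0 < x) (hxω : x < ω)
    (hxτ : α * x < τ) (hl : l < Lup) (hT : tauStar R l ω ≤ x) :
    (residual τ α x : EReal) ≤ maxFraction (l + 1) ∨ residual τ α x ≤ 1 / 4 := by
  obtain ⟨hlist, hlast⟩ := hadm x hx0 hxω hxτ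
  rcases exists_le_lt_or_le (f := fun l => tauStar R l ω) hl.le hT with ⟨k, hk, hkx, hxk⟩ | hLup
  · have hk := mem_Ico.1 hk
    exact .inl ((hlist (k + 1) (mem_Icc.2 ⟨by omega, hk.2⟩) hkx hxk.le).trans
      (maxFraction_antitone (Nat.succ_le_succ hk.1)))
  · exact .inr ((hlast hLup).trans (tauStar_one_half_le_quarter _))

theorem Admissible.binEntropy_residual_le (hadm : Admissible τ Lup ω α R) (h1 : α < 1)
    (hx0 : 0 < x) (hxω : x < ω) (hxτ : α * x < τ) (hT : tauStar R Lup ω ≤ x) :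
    Real.binEntropy (2 * residual τ α x) ≤ (1 - secondRate α x ω R) * Real.log 2 :=
  binEntropy_two_mul_le_of_le_tauStar (residual_pos h1 hxτ) ((hadm x hx0 hxω hxτ).2 hT)

variable (h0 : 0 < α) (h1 : α < 1) (hω0 : 0 ≤ ω) (hω1 : ω ≤ 1)
include h0 h1 hω0 hω1

theorem Admissible.residual_lt (hadm : Admissible τ Lup ω α R) (hxω : x ≤ ω) (hxτ : α * x ≤ τ)
    (hl : l < Lup) (hT : tauStar R l ω < x) :
    (residual τ α x : EReal) < maxFraction (l + 1) ∨ residual τ α x < 1 / 4 := by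
  obtain ⟨x', hTx', hx'⟩ := exists_between hT
  have hlt := residual_strictAnti (τ := τ) h0 h1 hx'
  refine (hadm.residual_le ((tauStar_nonneg hω0 hω1 R l).trans_lt hTx') (hx'.trans_le hxω)
    ((mul_lt_mul_of_pos_left hx' h0).trans_le hxτ) hl hTx'.le).imp ?_ hlt.trans_le
  exact (EReal.coe_lt_coe_iff.2 hlt).trans_le

theorem Admissible.residual_lt_quarter (hadm : Admissible τ Lup ω α R) (hxω : x ≤ ω)
    (hxτ : α * x ≤ τ) (hT : tauStar R Lup ω < x) : residual τ α x < 1 / 4 := by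
  obtain ⟨x', hTx', hx'⟩ := exists_between hT
  exact (residual_strictAnti h0 h1 hx').trans_le
    (((hadm x' ((tauStar_nonneg hω0 hω1 R Lup).trans_lt hTx') (hx'.trans_le hxω)
      ((mul_lt_mul_of_pos_left hx' h0).trans_le hxτ)).2 hTx'.le).trans
      (tauStar_one_half_le_quarter _))

theorem Admissible.secondRate_mul_log_two_le (hadm : Admissible τ Lup ω α R) (hxω : x ≤ ω)
    (hxτ : α * x ≤ τ) (hT : tauStar R Lup ω < x) :
    secondRate α x ω R * Real.log 2 ≤ Real.log 2 - Real.binEntropy (2 * residual τ α x) := by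
  have hT0 := tauStar_nonneg hω0 hω1 R Lup
  have hrate : ContinuousAt (fun x => secondRate α x ω R * Real.log 2) x :=
    (continuousAt_secondRate (by linarith)).mul_const _
  have hent : Continuous fun x => Real.log 2 - Real.binEntropy (2 * residual τ α x) :=
    continuous_const.sub
      (Real.binEntropy_continuous.comp ((continuous_residual τ α).const_mul 2))
  refine le_of_tendsto_of_tendsto (hrate.tendsto.mono_left nhdsWithin_le_nhds)
    ((hent.tendsto x).mono_left nhdsWithin_le_nhds) (b := 𝓝[<] x) ?_
  filter_upwards [Ioo_mem_nhdsLT hT] with x' hx'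
  have := hadm.binEntropy_residual_le h1 (hT0.trans_lt hx'.1) (hx'.2.trans_le hxω)
    ((mul_lt_mul_of_pos_left hx'.2 h0).trans_le hxτ) hx'.1.le
  linarith

theorem Admissible.binEntropy_sub_lt (hadm : Admissible τ Lup ω α R) (hxω : x ≤ ω)
    (hxτ : α * x ≤ τ) (hLup : tauStar R Lup ω < x) (hT : tauStar R 1 ω < T) :
    (1 - ω + x) * max 0 (Real.binEntropy (x / (1 - ω + x)) -
        Real.binEntropy (johnsonRadius T (1 - ω + x))) <
      (1 - α) / α * (Real.log 2 - Real.binEntropy (2 * residual τ α x)) := by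
  have hν : 0 < 1 - ω + x := by linarith [tauStar_nonneg hω0 hω1 R Lup]
  have hα : 0 < 1 - α := sub_pos.2 h1
  set ν := 1 - ω + x
  rcases le_or_gt (Real.binEntropy (x / ν) - Real.binEntropy (johnsonRadius T ν)) 0 with hle | hpos
  · rw [max_eq_left hle, mul_zero]
    exact mul_pos (div_pos hα h0) (sub_pos.2 (binEntropy_two_mul_lt_log_two
      (hadm.residual_lt_quarter h0 h1 hω0 hω1 hxω hxτ hLup)))
  rw [max_eq_right hpos.le, div_mul_eq_mul_div, lt_div_iff₀' h0]
  calc α * (ν * (Real.binEntropy (x / ν) - Real.binEntropy (johnsonRadius T ν)))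
      < α * (ν * (Real.binEntropy (x / ν) -
          Real.binEntropy (johnsonRadius (tauStar R 1 ω) ν))) := by
        gcongr α * (ν * ?_)
        exact binEntropy_sub_johnsonRadius_lt _ (tauStar_nonneg hω0 hω1 R 1) hT hν hpos
    _ = (1 - α) * (secondRate α x ω R * Real.log 2) :=
        (one_sub_mul_secondRate_mul_log_two h1).symm
    _ ≤ (1 - α) * (Real.log 2 - Real.binEntropy (2 * residual τ α x)) := by
        gcongr
        exact hadm.secondRate_mul_log_two_le h0 h1 hω0 hω1 hxω hxτ hLup

end Admissible

section Limits

variable {ι : Type*} {F : Filter ι} {n N a b m : ι → ℕ} {x y ν β r κ θ : ℝ}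

theorem tendsto_div_of_tendsto_div (hn : ∀ᶠ j in F, 0 < n j)
    (ha : Tendsto (fun j => (a j : ℝ) / n j) F (𝓝 x))
    (hb : Tendsto (fun j => (b j : ℝ) / n j) F (𝓝 y)) (hy : y ≠ 0) :
    Tendsto (fun j => (a j : ℝ) / b j) F (𝓝 (x / y)) := by
  refine (ha.div hb hy).congr' ?_
  filter_upwards [hn] with j hj
  rw [Pi.div_apply, div_div_div_cancel_right₀ (by positivity)]

theorem tendsto_atTop_of_tendsto_div (hn : Tendsto n F atTop)
    (ha : Tendsto (fun j => (a j : ℝ) / n j) F (𝓝 x)) (hx : 0 < x) : Tendsto a F atTop := by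
  refine tendsto_natCast_atTop_iff (R := ℝ).1 ?_
  refine (ha.pos_mul_atTop hx (tendsto_natCast_atTop_atTop.comp hn)).congr' ?_
  filter_upwards [hn.eventually_gt_atTop 0] with j hj
  rw [Function.comp_apply, div_mul_cancel₀ _ (by positivity)]

theorem tendsto_sub_div (hn : ∀ᶠ j in F, 0 < n j) (hle : ∀ j, a j ≤ n j)
    (ha : Tendsto (fun j => (a j : ℝ) / n j) F (𝓝 x)) :
    Tendsto (fun j => ((n j - a j : ℕ) : ℝ) / n j) F (𝓝 (1 - x)) := by
  refine (ha.const_sub 1).congr' ?_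
  filter_upwards [hn] with j hj
  rw [Nat.cast_sub (hle j), sub_div, div_self (by positivity)]

theorem eventually_mul_sub_lt (hn : ∀ᶠ j in F, 0 < n j) (hN : ∀ᶠ j in F, 0 < N j)
    (hNn : Tendsto (fun j => (N j : ℝ) / n j) F (𝓝 ν)) (hν : ν ≠ 0)
    (hm : Tendsto (fun j => (m j : ℝ) / N j) F (𝓝 r)) (hr : r * (1 - r) < θ / ν) :
    ∀ᶠ j in F, (m j : ℝ) * (N j - m j) < θ * n j * N j := by
  filter_upwards [(hm.mul (hm.const_sub 1)).eventually_lt (tendsto_const_nhds.div hNn hν) hr,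
    hn, hN] with j hj hn hN
  have hsq : (0 : ℝ) < N j * N j := by positivity
  calc (m j : ℝ) * (N j - m j) = m j / N j * (1 - m j / N j) * (N j * N j) := by field_simp
    _ < θ / (N j / n j) * (N j * N j) := mul_lt_mul_of_pos_right hj hsq
    _ = θ * n j * N j := by field_simp

theorem eventually_pow_mul_exp_le (k : ℕ) {φ : ι → ℝ} {c : ℝ} (hn : ∀ᶠ j in F, 0 < n j)
    (hN : Tendsto N F atTop) (hNn : Tendsto (fun j => (N j : ℝ) / n j) F (𝓝 ν))
    (hφ : Tendsto φ F (𝓝 c)) (hb : Tendsto (fun j => (b j : ℝ) / n j) F (𝓝 β))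
    (h : ν * c < β * κ) :
    ∀ᶠ j in F, (N j + 1 : ℝ) ^ k * Real.exp (N j * φ j) ≤ Real.exp (b j * κ) := by
  have hlog : Tendsto (fun j => k * (Real.log (N j + 1) / N j)) F (𝓝 0) := by
    simpa using (tendsto_log_succ_div.comp hN).const_mul (k : ℝ)
  have hleft : Tendsto (fun j => (N j : ℝ) / n j * (k * (Real.log (N j + 1) / N j) + φ j)) F
      (𝓝 (ν * c)) := by
    simpa using hNn.mul (hlog.add hφ)
  filter_upwards [hleft.eventually_lt (hb.mul_const κ) h, hn, hN.eventually_gt_atTop 0]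
    with j hj hn hN
  rw [← Real.exp_log (by positivity : 0 < (N j + 1 : ℝ) ^ k), ← Real.exp_add, Real.exp_le_exp,
    Real.log_pow]
  rw [div_mul_eq_mul_div, div_mul_eq_mul_div, div_lt_div_iff_of_pos_right (by positivity)] at hj
  calc k * Real.log (N j + 1) + N j * φ j
      = N j * (k * (Real.log (N j + 1) / N j) + φ j) := by field_simp
    _ ≤ b j * κ := hj.le

end Limits

/-- A second stage of length `n₂` correcting `r` errors can tell apart the codewords of weight `w`
which are still possible after `e` errors in a first stage of length `n₁`, for every first-stage
code in which any `l + 1` words share at most `w - ρ l * n₁` ones, for `l = 1, …, Lup`. -/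
def SecondStageSolvable (ρ : ℕ → ℝ) (Lup n₁ n₂ w e r : ℕ) : Prop :=
  ∀ C : Finset (Finset (Fin n₁)), (∀ A ∈ C, #A = w) →
    (∀ l ∈ Icc 1 Lup, Spread C w l (ρ l * n₁)) →
    ∀ Y : Finset (Fin n₁), #Y + e = w → HasCode n₂ #{A ∈ C | Y ⊆ A} r

section SecondStage

variable {ρ : ℕ → ℝ} {Lup l n₁ n₂ w e r m : ℕ}

theorem secondStageSolvable_of_hasCode (hl : l ∈ Icc 1 Lup) (he : e < ρ l * n₁)
    (h : HasCode n₂ l r) : SecondStageSolvable ρ Lup n₁ n₂ w e r := by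
  intro C _ hC Y hY
  refine h.mono ((hC l hl).card_list_le ?_) le_rfl
  rw [← hY]
  push_cast
  linarith

theorem secondStageSolvable_of_le_exp (hLup : 0 < Lup) (hw : w ≤ n₁) {N : ℕ}
    (hN : N = n₁ - w + e) (hmN : 2 * m ≤ N) (hm : (m : ℝ) * (N - m) < ρ 1 * n₁ * N)
    (h : ∀ K : ℕ, (K : ℝ) ≤ (N + 1 : ℝ) ^ 4 * Real.exp (N *
      max 0 (Real.binEntropy (e / N) - Real.binEntropy (m / N))) → HasCode n₂ K r) :
    SecondStageSolvable ρ Lup n₁ n₂ w e r := by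
  intro C hCw hC Y hY
  have hYc : #Yᶜ = N := by
    rw [card_compl, Fintype.card_fin]
    omega
  have he : w - #Y = e := by omega
  have hlist := (hC 1 (left_mem_Icc.2 hLup)).card_list_le_exp (m := m) (Y := Y) hCw
    (by omega) (by rwa [hYc]) (by rwa [hYc])
  rw [hYc, he] at hlist
  exact h _ hlist

end SecondStage

section EventuallySolvable

variable {ι : Type*} {F : Filter ι} {ρ : ℕ → ℝ} {Lup l : ℕ} {n₁ n₂ w e r : ι → ℕ} {ω x y β T : ℝ}

theorem eventually_secondStageSolvable_of_hasCode (hl : l ∈ Icc 1 Lup) (hn₁ : ∀ᶠ j in F, 0 < n₁ j)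
    (hx : Tendsto (fun j => (e j : ℝ) / n₁ j) F (𝓝 x)) (hxl : x < ρ l)
    (h : ∀ᶠ j in F, HasCode (n₂ j) l (r j)) :
    ∀ᶠ j in F, SecondStageSolvable ρ Lup (n₁ j) (n₂ j) (w j) (e j) (r j) := by
  filter_upwards [hx.eventually_lt_const hxl, hn₁, h] with j hj hn₁ hcode
  exact secondStageSolvable_of_hasCode hl ((div_lt_iff₀ (by positivity)).1 hj) hcode

theorem eventually_secondStageSolvable_of_binEntropy_lt (hLup : 0 < Lup)
    (hn₁ : Tendsto n₁ F atTop) (hw : ∀ j, w j ≤ n₁ j)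
    (hω : Tendsto (fun j => (w j : ℝ) / n₁ j) F (𝓝 ω))
    (hx : Tendsto (fun j => (e j : ℝ) / n₁ j) F (𝓝 x))
    (hβ : Tendsto (fun j => (n₂ j : ℝ) / n₁ j) F (𝓝 β)) (hβ0 : 0 < β)
    (hr : Tendsto (fun j => (r j : ℝ) / n₂ j) F (𝓝 y)) (hy0 : 0 ≤ y) (hy : y < 1 / 4)
    (hν : 0 < 1 - ω + x) (hT0 : 0 ≤ T) (hT : T < ρ 1)
    (hrate : (1 - ω + x) * max 0 (Real.binEntropy (x / (1 - ω + x)) -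
      Real.binEntropy (johnsonRadius T (1 - ω + x))) <
        β * (Real.log 2 - Real.binEntropy (2 * y))) :
    ∀ᶠ j in F, SecondStageSolvable ρ Lup (n₁ j) (n₂ j) (w j) (e j) (r j) := by
  set ν := 1 - ω + x
  let N j := n₁ j - w j + e j
  let m j := ⌊johnsonRadius T ν * N j⌋₊
  have hn₁pos := hn₁.eventually_gt_atTop 0
  have hNn₁ : Tendsto (fun j => (N j : ℝ) / n₁ j) F (𝓝 ν) := by
    simpa only [N, Nat.cast_add, add_div] using (tendsto_sub_div hn₁pos hw hω).add hx
  have hNtop := tendsto_atTop_of_tendsto_div hn₁ hNn₁ hν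
  have heN : Tendsto (fun j => (e j : ℝ) / N j) F (𝓝 (x / ν)) :=
    tendsto_div_of_tendsto_div hn₁pos hx hNn₁ hν.ne'
  have hmN : Tendsto (fun j => (m j : ℝ) / N j) F (𝓝 (johnsonRadius T ν)) :=
    (tendsto_floor_mul_div (johnsonRadius_nonneg hT0 hν.le)).comp hNtop
  have hexcess := tendsto_const_nhds (x := (0 : ℝ)).max
    (((Real.binEntropy_continuous.tendsto _).comp heN).sub
      ((Real.binEntropy_continuous.tendsto _).comp hmN))
  obtain ⟨κ, hκ, hκy⟩ := exists_between ((div_lt_iff₀' hβ0).2 hrate)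
  filter_upwards [
    eventually_mul_sub_lt hn₁pos (hNtop.eventually_gt_atTop 0) hNn₁ hν.ne' hmN
      ((johnsonRadius_mul_one_sub_le T ν).trans_lt (div_lt_div_of_pos_right hT hν)),
    eventually_pow_mul_exp_le 4 hn₁pos hNtop hNn₁ hexcess hβ ((div_lt_iff₀' hβ0).1 hκ),
    eventually_hasCode_of_lt_log_two_sub hy0 hy hκy (tendsto_atTop_of_tendsto_div hn₁ hβ hβ0) hr]
    with j hjohnson hexp hcode
  have hm : 2 * m j ≤ N j := by
    have hfloor : (m j : ℝ) ≤ 1 / 2 * N j := (Nat.floor_le (by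
      have := johnsonRadius_nonneg hT0 hν.le
      positivity)).trans (by gcongr; exact johnsonRadius_le_half T ν)
    exact_mod_cast (by linarith : (2 : ℝ) * m j ≤ N j)
  exact secondStageSolvable_of_le_exp hLup (hw j) rfl hm hjohnson
    fun K hK => hcode K (hK.trans hexp)

end EventuallySolvable

section Uniform

variable {τ α ω R x : ℝ} {ρ : ℕ → ℝ} {Lup : ℕ}

theorem tendsto_sub_div_residual {ι : Type*} {F : Filter ι} {n n₁ t e : ι → ℕ} (h1 : α < 1)
    (hn : ∀ᶠ j in F, 0 < n j) (hn₁ : ∀ᶠ j in F, 0 < n₁ j) (hle : ∀ j, n₁ j ≤ n j)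
    (het : ∀ j, e j ≤ t j) (hα : Tendsto (fun j => (n₁ j : ℝ) / n j) F (𝓝 α))
    (hτ : Tendsto (fun j => (t j : ℝ) / n j) F (𝓝 τ))
    (hx : Tendsto (fun j => (e j : ℝ) / n₁ j) F (𝓝 x)) :
    Tendsto (fun j => ((t j - e j : ℕ) : ℝ) / (n j - n₁ j : ℕ)) F (𝓝 (residual τ α x)) := by
  refine tendsto_div_of_tendsto_div hn ?_ (tendsto_sub_div hn hle hα) (sub_pos.2 h1).ne'
  refine (hτ.sub (hα.mul hx)).congr' ?_
  filter_upwards [hn₁] with j hj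
  rw [Nat.cast_sub (het j), sub_div]
  field_simp

theorem Admissible.eventually_secondStageSolvable {ι : Type*} {F : Filter ι} [NeBot F]
    {n n₁ w t e : ι → ℕ} (hadm : Admissible τ Lup ω α R) (h0 : 0 < α) (h1 : α < 1)
    (hω0 : 0 ≤ ω) (hω1 : ω ≤ 1) (hLup : 0 < Lup) (hρ : ∀ l ∈ Icc 1 Lup, tauStar R l ω < ρ l)
    (hn : Tendsto n F atTop) (hle : ∀ j, n₁ j ≤ n j) (hw : ∀ j, w j ≤ n₁ j)
    (het : ∀ j, e j ≤ t j) (hew : ∀ j, e j ≤ w j)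
    (hα : Tendsto (fun j => (n₁ j : ℝ) / n j) F (𝓝 α))
    (hω : Tendsto (fun j => (w j : ℝ) / n₁ j) F (𝓝 ω))
    (hτ : Tendsto (fun j => (t j : ℝ) / n j) F (𝓝 τ))
    (hx : Tendsto (fun j => (e j : ℝ) / n₁ j) F (𝓝 x)) :
    ∀ᶠ j in F, SecondStageSolvable ρ Lup (n₁ j) (n j - n₁ j) (w j) (e j) (t j - e j) := by
  have hα1 : 0 < 1 - α := sub_pos.2 h1
  have hn₀ := hn.eventually_gt_atTop 0
  have hn₁ := tendsto_atTop_of_tendsto_div hn hα h0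
  have hn₁₀ := hn₁.eventually_gt_atTop 0
  have hn₂ := tendsto_atTop_of_tendsto_div hn (tendsto_sub_div hn₀ hle hα) hα1
  have hres := tendsto_sub_div_residual h1 hn₀ hn₁₀ hle het hα hτ hx
  have hxω : x ≤ ω := le_of_tendsto_of_tendsto' hx hω fun j => by gcongr; exact hew j
  have hres0 : 0 ≤ residual τ α x := ge_of_tendsto' hres fun j => by positivity
  have hxτ : α * x ≤ τ := by
    rwa [residual, le_div_iff₀ hα1, zero_mul, sub_nonneg] at hres0
  rcases lt_or_ge x (ρ 1) with hx1 | hx1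
  · exact eventually_secondStageSolvable_of_hasCode (left_mem_Icc.2 hLup) hn₁₀ hx hx1
      (.of_forall fun j => hasCode_of_le_one le_rfl)
  rcases exists_le_lt_or_le hLup hx1 with ⟨l, hl, hlx, hxl⟩ | hLx
  · obtain ⟨hl1, hlLup⟩ := mem_Ico.1 hl
    refine eventually_secondStageSolvable_of_hasCode (mem_Icc.2 ⟨by omega, hlLup⟩) hn₁₀ hx hxl ?_
    rcases hadm.residual_lt h0 h1 hω0 hω1 hxω hxτ hlLup
      ((hρ l (mem_Icc.2 ⟨hl1, hlLup.le⟩)).trans_le hlx) with hlt | hlt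
    · exact eventually_hasCode_of_lt_maxFraction hlt hn₂ hres
    · exact eventually_hasCode_of_lt_quarter _ hres0 hlt hn₂ hres
  · have hTx := (hρ Lup (right_mem_Icc.2 hLup)).trans_le hLx
    obtain ⟨T, hT, hTρ⟩ := exists_between (hρ 1 (left_mem_Icc.2 hLup))
    have hx0 : 0 < x := (tauStar_nonneg hω0 hω1 R Lup).trans_lt hTx
    exact eventually_secondStageSolvable_of_binEntropy_lt hLup hn₁ hw hω hx
      (tendsto_div_of_tendsto_div hn₀ (tendsto_sub_div hn₀ hle hα) hα h0.ne') (div_pos hα1 h0)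
      hres hres0 (hadm.residual_lt_quarter h0 h1 hω0 hω1 hxω hxτ hTx) (by linarith)
      ((tauStar_nonneg hω0 hω1 R 1).trans hT.le) hTρ
      (hadm.binEntropy_sub_lt h0 h1 hω0 hω1 hxω hxτ hTx hT)

/-- Uniformity in the number `e` of first-stage errors comes from compactness: along a sequence of
bad values of `e`, the fractions `e / n₁` would accumulate somewhere in `[0, 1]`. -/
theorem Admissible.eventually_forall_secondStageSolvable {n₁ w t : ℕ → ℕ}
    (hadm : Admissible τ Lup ω α R) (h0 : 0 < α) (h1 : α < 1)
    (hω0 : 0 ≤ ω) (hω1 : ω ≤ 1) (hLup : 0 < Lup) (hρ : ∀ l ∈ Icc 1 Lup, tauStar R l ω < ρ l)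
    (hle : ∀ n, n₁ n ≤ n) (hw : ∀ n, w n ≤ n₁ n)
    (hα : Tendsto (fun n => (n₁ n : ℝ) / n) atTop (𝓝 α))
    (hω : Tendsto (fun n => (w n : ℝ) / n₁ n) atTop (𝓝 ω))
    (hτ : Tendsto (fun n => (t n : ℝ) / n) atTop (𝓝 τ)) :
    ∀ᶠ n in atTop, ∀ e ≤ t n, e ≤ w n →
      SecondStageSolvable ρ Lup (n₁ n) (n - n₁ n) (w n) e (t n - e) := by
  by_contra hcon
  obtain ⟨φ, hφ, hbad⟩ := extraction_of_frequently_atTop (not_eventually.1 hcon)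
  push Not at hbad
  choose e het hew hbad using hbad
  have hmem (j) : (e j : ℝ) / n₁ (φ j) ∈ Set.Icc (0 : ℝ) 1 :=
    ⟨by positivity, div_le_one_of_le₀ (by exact_mod_cast (hew j).trans (hw _)) (by positivity)⟩
  obtain ⟨x, -, ψ, hψ, hx⟩ := isCompact_Icc.tendsto_subseq hmem
  have hφψ := hφ.tendsto_atTop.comp hψ.tendsto_atTop
  obtain ⟨j, hj⟩ := (hadm.eventually_secondStageSolvable h0 h1 hω0 hω1 hLup hρ hφψ
    (fun _ => hle _) (fun _ => hw _) (fun _ => het _) (fun _ => hew _) (hα.comp hφψ)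
    (hω.comp hφψ) (hτ.comp hφψ) hx).exists
  exact hbad (ψ j) hj

end Uniform

section Rate

variable {τ α ω R R' : ℝ} {Lup n n₁ n₂ t M : ℕ}

theorem twoStageRate_nonneg (τ : ℝ) : 0 ≤ twoStageRate τ := by
  refine le_limsup_of_frequently_le' (Eventually.of_forall fun n => ?_).frequently
  exact EReal.coe_nonneg.2 (div_nonneg
    (div_nonneg (Real.log_natCast_nonneg _) (Real.log_nonneg one_le_two)) n.cast_nonneg)

theorem TwoStageAchievable.le_twoStageMax (h : TwoStageAchievable n₁ n₂ t M) (hn₁ : 1 < n₁)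
    (hn₂ : 0 < n₂) : M ≤ twoStageMax (n₁ + n₂) t :=
  le_csSup (bddAbove_twoStageSizes _ _) ⟨_, _, hn₁, hn₂, rfl, h⟩

theorem le_twoStageRate_of_eventually_exp_le {c : ℝ}
    (h : ∀ᶠ n : ℕ in atTop, Real.exp (n * (c * Real.log 2)) ≤ twoStageMax n ⌊τ * n⌋₊) :
    (c : EReal) ≤ twoStageRate τ := by
  refine le_limsup_of_frequently_le' (Eventually.frequently ?_)
  filter_upwards [h, eventually_gt_atTop 0] with n hn hn0
  rw [EReal.coe_le_coe_iff, le_div_iff₀ (by positivity),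
    Real.le_logb_iff_rpow_le one_lt_two ((Real.exp_pos _).trans_le hn),
    Real.rpow_def_of_pos two_pos]
  convert hn using 2
  ring

theorem Admissible.mul_le_twoStageRate_of_lt (hadm : Admissible τ Lup ω α R) (hτ : 0 ≤ τ)
    (hω0 : 0 ≤ ω) (hω1 : ω ≤ 1) (h0 : 0 < α) (h1 : α < 1) (hLup : 0 < Lup) (hR'0 : 0 ≤ R')
    (hR' : R' < R) (hR : R ≤ entropy ω) : ((α * R' : ℝ) : EReal) ≤ twoStageRate τ := by
  obtain ⟨ρ, hρ, hfirst⟩ := exists_firstStage hω0 hω1 hLup hR'0 hR' hR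
  have hle (n : ℕ) : ⌈α * n⌉₊ ≤ n :=
    Nat.ceil_le.2 (mul_le_of_le_one_left n.cast_nonneg h1.le)
  have hα : Tendsto (fun n : ℕ => (⌈α * n⌉₊ : ℝ) / n) atTop (𝓝 α) :=
    (tendsto_nat_ceil_mul_div_atTop h0.le).comp tendsto_natCast_atTop_atTop
  have hn₁ := tendsto_atTop_of_tendsto_div tendsto_id hα h0
  have hn₂ := tendsto_atTop_of_tendsto_div tendsto_id
    (tendsto_sub_div (eventually_gt_atTop 0) hle hα) (sub_pos.2 h1)
  refine le_twoStageRate_of_eventually_exp_le ?_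
  filter_upwards [hn₁.eventually hfirst, hn₁.eventually_gt_atTop 1, hn₂.eventually_gt_atTop 0,
    hadm.eventually_forall_secondStageSolvable h0 h1 hω0 hω1 hLup hρ hle
      (fun _ => floor_mul_le hω1 _) hα ((tendsto_floor_mul_div hω0).comp hn₁)
      (tendsto_floor_mul_div hτ)]
    with n ⟨C, hCw, hCcard, hC⟩ hn₁ hn₂ hsecond
  have hCpos : (0 : ℝ) < #C := (Real.exp_pos _).trans_le hCcard
  have hach := twoStageAchievable_of_hasCode hCw (card_pos.1 (by exact_mod_cast hCpos))
    fun Y hY hYt => hsecond _ hYt (Nat.sub_le _ _) C hCw hC Y (Nat.add_sub_cancel' hY)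
  have hmax := hach.le_twoStageMax hn₁ hn₂
  rw [Nat.add_sub_cancel' (hle n)] at hmax
  calc Real.exp (n * (α * R' * Real.log 2)) = Real.exp (α * n * (R' * Real.log 2)) := by ring_nf
    _ ≤ Real.exp (⌈α * n⌉₊ * (R' * Real.log 2)) := by gcongr; exact Nat.le_ceil _
    _ ≤ #C := hCcard
    _ ≤ _ := by exact_mod_cast hmax

theorem Admissible.mul_le_twoStageRate (hadm : Admissible τ Lup ω α R) (hτ : 0 ≤ τ)
    (hω : ω ∈ Set.Icc 0 1) (hα : α ∈ Set.Ico 0 1) (hLup : 0 < Lup) (hR0 : 0 ≤ R)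
    (hR : R ≤ entropy ω) : ((α * R : ℝ) : EReal) ≤ twoStageRate τ := by
  rcases (mul_nonneg hα.1 hR0).eq_or_lt with hzero | hpos
  · rw [← hzero]
    exact twoStageRate_nonneg τ
  have hR0 := pos_of_mul_pos_right hpos hα.1
  have hcont : Continuous fun R' : ℝ => ((α * R' : ℝ) : EReal) :=
    continuous_coe_real_ereal.comp (continuous_const_mul α)
  refine le_of_tendsto ((hcont.tendsto R).mono_left nhdsWithin_le_nhds : Tendsto _ (𝓝[<] R) _) ?_
  filter_upwards [Ioo_mem_nhdsLT hR0] with R' hR'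
  exact hadm.mul_le_twoStageRate_of_lt hτ hω.1 hω.2 (pos_of_mul_pos_left hpos hR0.le) hα.2 hLup
    hR'.1.le hR'.2 hR

end Rate

end ZChannel

theorem mainTheorem3 (τ : ℝ) (hτ₀ : 0 < τ) (hτ₁ : τ < 1) (Lup : ℕ) (hLup : 0 < Lup) :
    (⨆ ω ∈ Set.Icc (0 : ℝ) 1, ⨆ α ∈ Set.Ico (0 : ℝ) 1,
      ⨆ R ∈ {R : ℝ | 0 ≤ R ∧ R ≤ ZChannel.entropy ω ∧ ZChannel.Admissible τ Lup ω α R},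
        ((α * R : ℝ) : EReal)) ≤ ZChannel.twoStageRate τ :=
  iSup₂_le fun _ hω => iSup₂_le fun _ hα => iSup₂_le fun _ hR =>
    hR.2.2.mul_le_twoStageRate hτ₀.le hω hα hLup hR.1 hR.2.1
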